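/- Let $n\ge 2$, $0<\rho\le\infty$, let $B^n(\rho)\subset\mathbb R^n$ be the open ball of radius $\rho$ about the origin, and let $\phi=\phi(r,s)$ be a positive smooth function on $[0,\rho)\times(-\rho,\rho)$ such that $$F(x,y)=|y|\,\phi(r,s),\qquad r=|x|,\quad s=\frac{\langle x,y\rangle}{|y|},$$ is a Finsler metric on $B^n(\rho)$ (smooth for $y\neq0$, positive for $y\ne0$, positively homogeneous of degree one in $y$, and with $g_{ij}=\frac12[F^2]_{y^iy^j}$ positive definite). Put $$Q=\frac1{2r}\,\frac{s\phi_{rs}+r\phi_{ss}-\phi_r}{\phi-s\phi_s+(r^2-s^2)\phi_{ss}},\qquad P=\frac{1}{2r\phi}(s\phi_r+r\phi_s)-\frac{Q}{\phi}\{s\phi+(r^2-s^2)\phi_s\},$$ $$R_1=P^2-\frac1r(sP_r+rP_s)+2Q\,[1+sP+(r^2-s^2)P_s],$$ $$R_2=\frac1r(2Q_r-sQ_{rs}-rQ_{ss})+2Q(2Q-sQ_s)+(r^2-s^2)(2QQ_{ss}-[Q_s]^2).$$ Let $\mathrm{Ric}=R^m{}_m$ be the Ricci curvature of $F$, where $R^i{}_k=R_j{}^i{}_{kl}y^jy^l$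 and $R_j{}^i{}_{kl}$ is the Riemann curvature tensor of the Berwald connection. Let $K$ be a real constant. Then $$\mathrm{Ric}=(n-1)KF^2\quad\text{for all }x\in B^n(\rho),\ y\neq0$$ if and only if $$(n-1)K\phi^2=(n-1)R_1+(r^2-s^2)R_2\quad\text{for all }(r,s)\text{ with }0<r<\rho,\ |s|\le r.$$ -/

import Mathlib

open scoped ContDiff

noncomputable section

namespace Finsler

/-- The coordinate space `ℝⁿ` with its Euclidean norm. Functions `f : E n → E n → ℝ` are functions
`f x y` of a point `x` and a tangent vector `y ∈ T_x ℝⁿ ≅ ℝⁿ`. -/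
abbrev E (n : ℕ) : Type := EuclideanSpace ℝ (Fin n)

variable {n : ℕ}

/-- `∂f/∂xⁱ`, the partial derivative in the `i`-th position coordinate. -/
def dX (i : Fin n) (f : E n → E n → ℝ) : E n → E n → ℝ :=
  fun x y => fderiv ℝ (fun z => f z y) x (EuclideanSpace.single i 1)

/-- `∂f/∂yⁱ`, the partial derivative in the `i`-th fibre coordinate. -/
def dY (i : Fin n) (f : E n → E n → ℝ) : E n → E n → ℝ :=
  fun x y => fderiv ℝ (fun w => f x w) y (EuclideanSpace.single i 1)

/-- The fundamental tensor `g_{ij} = ½ [F²]_{yⁱ yʲ}`. -/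
def fundamentalTensor (F : E n → E n → ℝ) (x y : E n) : Matrix (Fin n) (Fin n) ℝ :=
  Matrix.of fun i j => (1 / 2) * dY j (dY i fun x y => F x y ^ 2) x y

/-- `F` is a Finsler metric on the open set `U ⊆ ℝⁿ`: smooth on the slit tangent bundle, positive
off the zero section, positively homogeneous of degree one, and strongly convex. -/
structure IsFinslerMetric (U : Set (E n)) (F : E n → E n → ℝ) : Prop where
  smooth : ContDiffOn ℝ ∞ (fun p : E n × E n => F p.1 p.2) (U ×ˢ {y | y ≠ 0})
  pos : ∀ x ∈ U, ∀ y, y ≠ 0 → 0 < F x y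
  homogeneous : ∀ x ∈ U, ∀ y, ∀ c : ℝ, 0 < c → F x (c • y) = c * F x y
  posDef : ∀ x ∈ U, ∀ y, y ≠ 0 → (fundamentalTensor F x y).PosDef

/-- The geodesic (spray) coefficients
`Gⁱ = ¼ g^{il} ([F²]_{xᵏ yˡ} yᵏ - [F²]_{xˡ})`. -/
def spray (F : E n → E n → ℝ) (i : Fin n) (x y : E n) : ℝ :=
  (1 / 4) * ∑ l, (fundamentalTensor F x y)⁻¹ i l *
    ((∑ k, dY l (dX k fun x y => F x y ^ 2) x y * y k) - dX l (fun x y => F x y ^ 2) x y)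

/-- The nonlinear connection `Nⁱ_j = ∂Gⁱ/∂yʲ`. -/
def nonlinearConn (F : E n → E n → ℝ) (i j : Fin n) : E n → E n → ℝ :=
  dY j (spray F i)

/-- The coefficients `Γⁱ_{jk} = ∂²Gⁱ/∂yʲ∂yᵏ` of the Berwald connection. -/
def berwaldConn (F : E n → E n → ℝ) (i j k : Fin n) : E n → E n → ℝ :=
  dY k (nonlinearConn F i j)

/-- The horizontal derivative `δf/δxᵏ = ∂f/∂xᵏ - Nᵐ_k ∂f/∂yᵐ`. -/
def horizontalDeriv (F : E n → E n → ℝ) (k : Fin n) (f : E n → E n → ℝ) (x y : E n) : ℝ :=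
  dX k f x y - ∑ m, nonlinearConn F m k x y * dY m f x y

/-- The Riemann curvature tensor of the Berwald connection,
`R_jⁱ_{kl} = δΓⁱ_{jl}/δxᵏ - δΓⁱ_{jk}/δxˡ + Γⁱ_{km} Γᵐ_{jl} - Γⁱ_{lm} Γᵐ_{jk}`. -/
def berwaldCurvature (F : E n → E n → ℝ) (i j k l : Fin n) (x y : E n) : ℝ :=
  horizontalDeriv F k (berwaldConn F i j l) x y - horizontalDeriv F l (berwaldConn F i j k) x y
    + ∑ m, (berwaldConn F i k m x y * berwaldConn F m j l x y
        - berwaldConn F i l m x y * berwaldConn F m j k x y)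

/-- The Riemann curvature `Rⁱ_k = R_jⁱ_{kl} yʲ yˡ`. -/
def riemannCurvature (F : E n → E n → ℝ) (i k : Fin n) (x y : E n) : ℝ :=
  ∑ j, ∑ l, berwaldCurvature F i j k l x y * y j * y l

/-- The Ricci curvature `Ric = Rᵐ_m`. -/
def ricci (F : E n → E n → ℝ) (x y : E n) : ℝ :=
  ∑ m, riemannCurvature F m m x y

/-- `F = |y| φ(r, s)` with `r = |x|` and `s = ⟨x, y⟩ / |y|`. -/
def sphericalMetric (n : ℕ) (φ : ℝ → ℝ → ℝ) (x y : E n) : ℝ :=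
  ‖y‖ * φ ‖x‖ (inner ℝ x y / ‖y‖)

/-- The open ball `Bⁿ(ρ)` about the origin, `0 < ρ ≤ ∞`. -/
def ballAt (n : ℕ) (ρ : EReal) : Set (E n) :=
  {x | ((‖x‖ : ℝ) : EReal) < ρ}

/-- The domain `[0, ρ) × (-ρ, ρ)` of `φ`. -/
def profileDomain (ρ : EReal) : Set (ℝ × ℝ) :=
  {p | 0 ≤ p.1 ∧ (p.1 : EReal) < ρ ∧ ((|p.2| : ℝ) : EReal) < ρ}

/-- `∂f/∂r` of a function `f(r, s)`. -/
def dr (f : ℝ → ℝ → ℝ) : ℝ → ℝ → ℝ := fun r s => deriv (fun t => f t s) r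

/-- `∂f/∂s` of a function `f(r, s)`. -/
def ds (f : ℝ → ℝ → ℝ) : ℝ → ℝ → ℝ := fun r s => deriv (fun t => f r t) s

/-- `Q = (1 / 2r) (s φ_rs + r φ_ss - φ_r) / (φ - s φ_s + (r² - s²) φ_ss)`. -/
def Q (φ : ℝ → ℝ → ℝ) (r s : ℝ) : ℝ :=
  1 / (2 * r) * ((s * ds (dr φ) r s + r * ds (ds φ) r s - dr φ r s) /
    (φ r s - s * ds φ r s + (r ^ 2 - s ^ 2) * ds (ds φ) r s))

/-- `P = (1 / 2rφ) (s φ_r + r φ_s) - (Q / φ) (s φ + (r² - s²) φ_s)`. -/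
def P (φ : ℝ → ℝ → ℝ) (r s : ℝ) : ℝ :=
  1 / (2 * r * φ r s) * (s * dr φ r s + r * ds φ r s) -
    Q φ r s / φ r s * (s * φ r s + (r ^ 2 - s ^ 2) * ds φ r s)

/-- `R₁ = P² - (1/r) (s P_r + r P_s) + 2Q [1 + sP + (r² - s²) P_s]`. -/
def R1 (φ : ℝ → ℝ → ℝ) (r s : ℝ) : ℝ :=
  P φ r s ^ 2 - 1 / r * (s * dr (P φ) r s + r * ds (P φ) r s) +
    2 * Q φ r s * (1 + s * P φ r s + (r ^ 2 - s ^ 2) * ds (P φ) r s)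

/-- `R₂ = (1/r) (2Q_r - s Q_rs - r Q_ss) + 2Q (2Q - s Q_s) + (r² - s²) (2Q Q_ss - Q_s²)`. -/
def R2 (φ : ℝ → ℝ → ℝ) (r s : ℝ) : ℝ :=
  1 / r * (2 * dr (Q φ) r s - s * ds (dr (Q φ)) r s - r * ds (ds (Q φ)) r s) +
    2 * Q φ r s * (2 * Q φ r s - s * ds (Q φ) r s) +
    (r ^ 2 - s ^ 2) * (2 * Q φ r s * ds (ds (Q φ)) r s - ds (Q φ) r s ^ 2)

end Finsler

end

/-!
Write `r = |x|`, `s = ⟨x, y⟩ / |y|`. Away from `x = 0` the whole computation stays inside the class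
of functions `|y|ᵏ f(r, s)` (`profileLift k f`), because
`∂/∂yⁱ (|y|ᵏ f) = |y|ᵏ⁻² (k f - s f_s) yⁱ + |y|ᵏ⁻¹ f_s xⁱ` and
`∂/∂xⁱ (|y|ᵏ f) = |y|ᵏ (f_r / r) xⁱ + |y|ᵏ⁻¹ f_s yⁱ`.

Applied to `F² = |y|² φ²`, these rules give the fundamental tensor (`sum_fundamentalTensor_mul`).
Evaluating it on a suitable vector in the plane of `x` and `y` shows that positive definiteness
forces `φ - s φ_s + (r² - s²) φ_ss > 0` on `|s| ≤ r` (`spraySymbol_pos`), so that `P` and `Q` are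
smooth near the pairs `(r, s)` that occur. One then checks, without inverting `g`, that
`Gⁱ = |y| P yⁱ + |y|² Q xⁱ` solves `g G = ¼ ([F²]_{xᵏ yˡ} yᵏ - [F²]_{xˡ})`
(`sphericalMetric_spray`).

For any spray that is smooth and satisfies Euler's relation `Nⁱ_j yʲ = 2 Gⁱ`, contracting the
Berwald curvature twice with `y` gives (`riemannCurvature_eq`)
`Rⁱ_k = 2 ∂_{xᵏ} Gⁱ - yˡ ∂_{xˡ} Nⁱ_k + 2 Gᵐ ∂_{yᵐ} Nⁱ_k - Nⁱ_m Nᵐ_k`. Its trace for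
`Gⁱ = |y| A yⁱ + |y|² B xⁱ` is computed in `ricci_eq_of_spray_eq`, and with `A = P`, `B = Q` it
reads `Ric = |y|² ((n - 1) R₁ + (r² - s²) R₂)` for `x ≠ 0` (`ricci_sphericalMetric`).

Since `n ≥ 2`, every `(r, s)` with `0 < r < ρ`, `|s| ≤ r` is realised by some `x` and `y`
(`exists_vectors`), so the two conditions agree for `x ≠ 0`. The Ricci curvature is continuous on
the slit tangent bundle, which takes care of `x = 0`.
-/

noncomputable section

namespace Finsler

variable {n : ℕ}

/-! ### Partial derivatives on the slit tangent bundle -/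

section SlitCalculus

/-- `f x y` is smooth in `(x, y)` for `x ∈ V` and `y ≠ 0`. -/
def SmoothOnSlit (V : Set (E n)) (f : E n → E n → ℝ) : Prop :=
  ContDiffOn ℝ ∞ (fun p : E n × E n => f p.1 p.2) (V ×ˢ {y | y ≠ 0})

variable {V : Set (E n)} {f g : E n → E n → ℝ} {x y : E n}

theorem isOpen_slit (hV : IsOpen V) : IsOpen (V ×ˢ {y : E n | y ≠ 0}) :=
  hV.prod isOpen_ne

theorem SmoothOnSlit.congr (hf : SmoothOnSlit V f)
    (h : ∀ x ∈ V, ∀ y, y ≠ 0 → g x y = f x y) : SmoothOnSlit V g :=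
  ContDiffOn.congr hf fun p hp => h p.1 hp.1 p.2 hp.2

theorem SmoothOnSlit.contDiffAt (hV : IsOpen V) (hf : SmoothOnSlit V f) (hx : x ∈ V)
    (hy : y ≠ 0) : ContDiffAt ℝ ∞ (fun p : E n × E n => f p.1 p.2) (x, y) :=
  ContDiffOn.contDiffAt hf ((isOpen_slit hV).mem_nhds (Set.mk_mem_prod hx hy))

theorem SmoothOnSlit.hasFDerivAt (hV : IsOpen V) (hf : SmoothOnSlit V f) (hx : x ∈ V)
    (hy : y ≠ 0) :
    HasFDerivAt (fun p : E n × E n => f p.1 p.2)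
      (fderiv ℝ (fun p : E n × E n => f p.1 p.2) (x, y)) (x, y) :=
  ((hf.contDiffAt hV hx hy).differentiableAt (by simp)).hasFDerivAt

theorem SmoothOnSlit.differentiableAt_left (hV : IsOpen V) (hf : SmoothOnSlit V f) (hx : x ∈ V)
    (hy : y ≠ 0) : DifferentiableAt ℝ (fun z => f z y) x :=
  (HasFDerivAt.comp (g := fun p : E n × E n => f p.1 p.2) (f := fun z => (z, y)) x
    (hf.hasFDerivAt hV hx hy) (hasFDerivAt_prodMk_left x y)).differentiableAt

theorem SmoothOnSlit.differentiableAt_right (hV : IsOpen V) (hf : SmoothOnSlit V f) (hx : x ∈ V)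
    (hy : y ≠ 0) : DifferentiableAt ℝ (fun w => f x w) y :=
  (HasFDerivAt.comp (g := fun p : E n × E n => f p.1 p.2) (f := fun w => (x, w)) y
    (hf.hasFDerivAt hV hx hy) (hasFDerivAt_prodMk_right x y)).differentiableAt

theorem SmoothOnSlit.dX_eq (hV : IsOpen V) (hf : SmoothOnSlit V f) (hx : x ∈ V)
    (hy : y ≠ 0) (i : Fin n) : dX i f x y =
      fderiv ℝ (fun p : E n × E n => f p.1 p.2) (x, y) (EuclideanSpace.single i 1, 0) := by
  have h : HasFDerivAt (fun z => f z y) _ x :=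
    HasFDerivAt.comp (g := fun p : E n × E n => f p.1 p.2) (f := fun z => (z, y)) x
      (hf.hasFDerivAt hV hx hy) (hasFDerivAt_prodMk_left x y)
  simp [dX, h.fderiv]

theorem SmoothOnSlit.dY_eq (hV : IsOpen V) (hf : SmoothOnSlit V f) (hx : x ∈ V)
    (hy : y ≠ 0) (i : Fin n) : dY i f x y =
      fderiv ℝ (fun p : E n × E n => f p.1 p.2) (x, y) (0, EuclideanSpace.single i 1) := by
  have h : HasFDerivAt (fun w => f x w) _ y :=
    HasFDerivAt.comp (g := fun p : E n × E n => f p.1 p.2) (f := fun w => (x, w)) y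
      (hf.hasFDerivAt hV hx hy) (hasFDerivAt_prodMk_right x y)
  simp [dY, h.fderiv]

theorem SmoothOnSlit.dX (hV : IsOpen V) (hf : SmoothOnSlit V f) (i : Fin n) :
    SmoothOnSlit V (dX i f) := by
  have h := (ContDiffOn.fderiv_of_isOpen (m := ∞) hf (isOpen_slit hV) (by simp)).clm_apply
    (contDiffOn_const (c := ((EuclideanSpace.single i 1, 0) : E n × E n)))
  exact h.congr fun p hp => hf.dX_eq hV hp.1 hp.2 i

theorem SmoothOnSlit.dY (hV : IsOpen V) (hf : SmoothOnSlit V f) (i : Fin n) :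
    SmoothOnSlit V (dY i f) := by
  have h := (ContDiffOn.fderiv_of_isOpen (m := ∞) hf (isOpen_slit hV) (by simp)).clm_apply
    (contDiffOn_const (c := ((0, EuclideanSpace.single i 1) : E n × E n)))
  exact h.congr fun p hp => hf.dY_eq hV hp.1 hp.2 i

theorem SmoothOnSlit.const (V : Set (E n)) (c : ℝ) : SmoothOnSlit V fun _ _ => c :=
  contDiffOn_const

theorem SmoothOnSlit.coordX (V : Set (E n)) (i : Fin n) : SmoothOnSlit V fun x _ => x i :=
  ((EuclideanSpace.proj (𝕜 := ℝ) i).contDiff.comp contDiff_fst).contDiffOn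

theorem SmoothOnSlit.coordY (V : Set (E n)) (i : Fin n) : SmoothOnSlit V fun _ y => y i :=
  ((EuclideanSpace.proj (𝕜 := ℝ) i).contDiff.comp contDiff_snd).contDiffOn

theorem SmoothOnSlit.add (hf : SmoothOnSlit V f) (hg : SmoothOnSlit V g) :
    SmoothOnSlit V fun x y => f x y + g x y := ContDiffOn.add hf hg

theorem SmoothOnSlit.sub (hf : SmoothOnSlit V f) (hg : SmoothOnSlit V g) :
    SmoothOnSlit V fun x y => f x y - g x y := ContDiffOn.sub hf hg

theorem SmoothOnSlit.mul (hf : SmoothOnSlit V f) (hg : SmoothOnSlit V g) :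
    SmoothOnSlit V fun x y => f x y * g x y := ContDiffOn.mul hf hg

theorem SmoothOnSlit.pow (hf : SmoothOnSlit V f) (k : ℕ) :
    SmoothOnSlit V fun x y => f x y ^ k := ContDiffOn.pow hf k

theorem SmoothOnSlit.inv (hf : SmoothOnSlit V f) (h : ∀ x ∈ V, ∀ y, y ≠ 0 → f x y ≠ 0) :
    SmoothOnSlit V fun x y => (f x y)⁻¹ :=
  ContDiffOn.inv hf fun p hp => h p.1 hp.1 p.2 hp.2

theorem SmoothOnSlit.sum {ι : Type*} {s : Finset ι} {f : ι → E n → E n → ℝ}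
    (hf : ∀ i ∈ s, SmoothOnSlit V (f i)) : SmoothOnSlit V fun x y => ∑ i ∈ s, f i x y :=
  ContDiffOn.sum hf

theorem SmoothOnSlit.prod {ι : Type*} {s : Finset ι} {f : ι → E n → E n → ℝ}
    (hf : ∀ i ∈ s, SmoothOnSlit V (f i)) : SmoothOnSlit V fun x y => ∏ i ∈ s, f i x y :=
  contDiffOn_prod hf

theorem dX_congr (hV : IsOpen V) (h : ∀ x ∈ V, ∀ y, y ≠ 0 → f x y = g x y) (hx : x ∈ V)
    (hy : y ≠ 0) (i : Fin n) : dX i f x y = dX i g x y := by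
  have : (fun z => f z y) =ᶠ[nhds x] fun z => g z y := by
    filter_upwards [hV.mem_nhds hx] with z hz using h z hz y hy
  simp only [dX, this.fderiv_eq]

theorem dY_congr (h : ∀ y, y ≠ 0 → f x y = g x y)
    (hy : y ≠ 0) (i : Fin n) : dY i f x y = dY i g x y := by
  have : (fun z => f x z) =ᶠ[nhds y] fun z => g x z := by
    filter_upwards [isOpen_ne.mem_nhds hy] with z hz using h z hz
  simp only [dY, this.fderiv_eq]

theorem dX_add (hf : DifferentiableAt ℝ (fun z => f z y) x)
    (hg : DifferentiableAt ℝ (fun z => g z y) x) (i : Fin n) :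
    dX i (fun x y => f x y + g x y) x y = dX i f x y + dX i g x y := by
  simp only [dX, fderiv_fun_add hf hg, add_apply]

theorem dY_add (hf : DifferentiableAt ℝ (fun w => f x w) y)
    (hg : DifferentiableAt ℝ (fun w => g x w) y) (i : Fin n) :
    dY i (fun x y => f x y + g x y) x y = dY i f x y + dY i g x y := by
  simp only [dY, fderiv_fun_add hf hg, add_apply]

theorem dX_mul (hf : DifferentiableAt ℝ (fun z => f z y) x)
    (hg : DifferentiableAt ℝ (fun z => g z y) x) (i : Fin n) :
    dX i (fun x y => f x y * g x y) x y = f x y * dX i g x y + g x y * dX i f x y := by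
  simp [dX, fderiv_fun_mul hf hg]

theorem dY_mul (hf : DifferentiableAt ℝ (fun w => f x w) y)
    (hg : DifferentiableAt ℝ (fun w => g x w) y) (i : Fin n) :
    dY i (fun x y => f x y * g x y) x y = f x y * dY i g x y + g x y * dY i f x y := by
  simp [dY, fderiv_fun_mul hf hg]

theorem dX_sum {ι : Type*} {s : Finset ι} {f : ι → E n → E n → ℝ}
    (hf : ∀ j ∈ s, DifferentiableAt ℝ (fun z => f j z y) x) (i : Fin n) :
    dX i (fun x y => ∑ j ∈ s, f j x y) x y = ∑ j ∈ s, dX i (f j) x y := by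
  simp only [dX, fderiv_fun_sum hf, sum_apply]

theorem dY_sum {ι : Type*} {s : Finset ι} {f : ι → E n → E n → ℝ}
    (hf : ∀ j ∈ s, DifferentiableAt ℝ (fun w => f j x w) y) (i : Fin n) :
    dY i (fun x y => ∑ j ∈ s, f j x y) x y = ∑ j ∈ s, dY i (f j) x y := by
  simp only [dY, fderiv_fun_sum hf, sum_apply]

theorem dX_coordX (i j : Fin n) (x y : E n) :
    dX i (fun x _ => x j) x y = if j = i then 1 else 0 := by
  have h : HasFDerivAt (fun z : E n => z j) (EuclideanSpace.proj (𝕜 := ℝ) j) x :=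
    (EuclideanSpace.proj (𝕜 := ℝ) j).hasFDerivAt
  simp [dX, h.fderiv]

theorem dY_coordY (i j : Fin n) (x y : E n) :
    dY i (fun _ y => y j) x y = if j = i then 1 else 0 := by
  have h : HasFDerivAt (fun z : E n => z j) (EuclideanSpace.proj (𝕜 := ℝ) j) y :=
    (EuclideanSpace.proj (𝕜 := ℝ) j).hasFDerivAt
  simp [dY, h.fderiv]

theorem dX_coordY (i j : Fin n) (x y : E n) : dX i (fun _ y => y j) x y = 0 := by
  simp [dX]

theorem dY_coordX (i j : Fin n) (x y : E n) : dY i (fun x _ => x j) x y = 0 := by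
  simp [dY]

theorem dX_mul_coordX (hf : DifferentiableAt ℝ (fun z => f z y) x) (i j : Fin n) :
    dX i (fun x y => f x y * x j) x y = (if j = i then f x y else 0) + x j * dX i f x y := by
  rw [dX_mul (g := fun x _ => x j) hf (by fun_prop), dX_coordX]; simp

theorem dX_mul_coordY (hf : DifferentiableAt ℝ (fun z => f z y) x) (i j : Fin n) :
    dX i (fun x y => f x y * y j) x y = y j * dX i f x y := by
  rw [dX_mul (g := fun _ y => y j) hf (by fun_prop), dX_coordY]; simp

theorem dY_mul_coordX (hf : DifferentiableAt ℝ (fun w => f x w) y) (i j : Fin n) :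
    dY i (fun x y => f x y * x j) x y = x j * dY i f x y := by
  rw [dY_mul (g := fun x _ => x j) hf (by fun_prop), dY_coordX]; simp

theorem dY_mul_coordY (hf : DifferentiableAt ℝ (fun w => f x w) y) (i j : Fin n) :
    dY i (fun x y => f x y * y j) x y = (if j = i then f x y else 0) + y j * dY i f x y := by
  rw [dY_mul (g := fun _ y => y j) hf (by fun_prop), dY_coordY]; simp

theorem dX_const_mul (c : ℝ) (hf : DifferentiableAt ℝ (fun z => f z y) x) (i : Fin n) :
    dX i (fun x y => c * f x y) x y = c * dX i f x y := by
  simp [dX, fderiv_const_mul hf]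

theorem dY_const_mul (c : ℝ) (hf : DifferentiableAt ℝ (fun w => f x w) y) (i : Fin n) :
    dY i (fun x y => c * f x y) x y = c * dY i f x y := by
  simp [dY, fderiv_const_mul hf]

theorem SmoothOnSlit.dY_comm (hV : IsOpen V) (hf : SmoothOnSlit V f) (hx : x ∈ V)
    (hy : y ≠ 0) (i j : Fin n) :
    Finsler.dY i (Finsler.dY j f) x y = Finsler.dY j (Finsler.dY i f) x y := by
  set h : E n × E n → ℝ := fun p => f p.1 p.2 with hh
  have hc : ContDiffAt ℝ ∞ h (x, y) := hf.contDiffAt hV hx hy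
  have hd : DifferentiableAt ℝ (fderiv ℝ h) (x, y) :=
    (hc.fderiv_right (m := ∞) (by simp)).differentiableAt (by simp)
  have key : ∀ i j : Fin n, Finsler.dY i (Finsler.dY j f) x y =
      fderiv ℝ (fderiv ℝ h) (x, y) (0, EuclideanSpace.single i 1)
        (0, EuclideanSpace.single j 1) := by
    intro i j
    rw [(hf.dY hV j).dY_eq hV hx hy]
    have he : (fun p : E n × E n => Finsler.dY j f p.1 p.2) =ᶠ[nhds (x, y)]
        fun p => fderiv ℝ h p (0, EuclideanSpace.single j 1) := by
      filter_upwards [(isOpen_slit hV).mem_nhds (Set.mk_mem_prod hx hy)] with p hp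
        using hf.dY_eq hV hp.1 hp.2 j
    rw [he.fderiv_eq, fderiv_clm_apply hd (by fun_prop)]
    simp
  rw [key, key]
  exact (hc.isSymmSndFDerivAt (by
    simpa using WithTop.coe_le_coe.2 (le_top : (2 : ℕ∞) ≤ ⊤))).eq _ _

end SlitCalculus

/-! ### Contraction of the Berwald curvature -/

section Ricci

variable {V : Set (E n)} {F : E n → E n → ℝ} {x y : E n}

section Tensors

variable (hV : IsOpen V) (hG : ∀ i, SmoothOnSlit V (spray F i))
include hV hG

theorem smoothOnSlit_nonlinearConn (i j : Fin n) : SmoothOnSlit V (nonlinearConn F i j) :=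
  (hG i).dY hV j

theorem smoothOnSlit_berwaldConn (i j k : Fin n) : SmoothOnSlit V (berwaldConn F i j k) :=
  ((hG i).dY hV j).dY hV k

theorem berwaldConn_comm (hx : x ∈ V) (hy : y ≠ 0) (i j k : Fin n) :
    berwaldConn F i j k x y = berwaldConn F i k j x y :=
  (hG i).dY_comm hV hx hy k j

theorem smoothOnSlit_horizontalDeriv {f : E n → E n → ℝ} (hf : SmoothOnSlit V f) (k : Fin n) :
    SmoothOnSlit V (horizontalDeriv F k f) :=
  (hf.dX hV k).sub (.sum fun m _ => (smoothOnSlit_nonlinearConn hV hG m k).mul (hf.dY hV m))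

theorem smoothOnSlit_ricci : SmoothOnSlit V (ricci F) := by
  have hΓ := smoothOnSlit_berwaldConn hV hG
  refine .sum fun m _ => .sum fun j _ => .sum fun l _ => .mul (.mul (.add (.sub
    (smoothOnSlit_horizontalDeriv hV hG (hΓ _ _ _) _)
    (smoothOnSlit_horizontalDeriv hV hG (hΓ _ _ _) _)) (.sum fun p _ => ?_))
    (.coordY V j)) (.coordY V l)
  exact ((hΓ _ _ _).mul (hΓ _ _ _)).sub ((hΓ _ _ _).mul (hΓ _ _ _))

end Tensors

variable (hV : IsOpen V) (hG : ∀ i, SmoothOnSlit V (spray F i))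
  (hE : ∀ i, ∀ x ∈ V, ∀ y, y ≠ 0 → ∑ j, nonlinearConn F i j x y * y j = 2 * spray F i x y)
include hV hG hE

/-- `Γⁱ_{jl} yʲ = Nⁱ_l`: the `yˡ`-derivative of Euler's relation `Nⁱ_j yʲ = 2 Gⁱ`. -/
theorem sum_berwaldConn_mul (hx : x ∈ V) (hy : y ≠ 0) (i l : Fin n) :
    ∑ j, berwaldConn F i j l x y * y j = nonlinearConn F i l x y := by
  have hN := smoothOnSlit_nonlinearConn hV hG
  have h := dY_congr (f := fun x y => ∑ j, nonlinearConn F i j x y * y j)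
    (g := fun x y => 2 * spray F i x y) (hE i x hx) hy l
  rw [dY_const_mul _ ((hG i).differentiableAt_right hV hx hy),
    dY_sum (f := fun j x y => nonlinearConn F i j x y * y j)
      fun j _ => ((hN i j).mul (.coordY V j)).differentiableAt_right hV hx hy] at h
  simp only [dY_mul_coordY ((hN i _).differentiableAt_right hV hx hy),
    Finset.sum_add_distrib, Finset.sum_ite_eq', Finset.mem_univ, if_true] at h
  have h2 : ∑ j, berwaldConn F i j l x y * y j = ∑ j, y j * dY l (nonlinearConn F i j) x y :=
    Finset.sum_congr rfl fun j _ => mul_comm _ _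
  have h3 : nonlinearConn F i l x y = dY l (spray F i) x y := rfl
  linarith

/-- `yʲ ∂Γⁱ_{jl}/∂yᵐ = 0`: differentiate `Γⁱ_{jl} yʲ = Nⁱ_l` and use the symmetry of `Γ`. This
removes the vertical part of the horizontal derivatives from the contracted curvature. -/
theorem sum_dY_berwaldConn_mul (hx : x ∈ V) (hy : y ≠ 0) (i l m : Fin n) :
    ∑ j, dY m (berwaldConn F i j l) x y * y j = 0 := by
  have hΓ := smoothOnSlit_berwaldConn hV hG
  have h := dY_congr (f := fun x y => ∑ j, berwaldConn F i j l x y * y j)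
    (g := nonlinearConn F i l) (fun y hy => sum_berwaldConn_mul hV hG hE hx hy i l) hy m
  rw [dY_sum (f := fun j x y => berwaldConn F i j l x y * y j)
      fun j _ => ((hΓ i j l).mul (.coordY V j)).differentiableAt_right hV hx hy] at h
  simp only [dY_mul_coordY ((hΓ i _ l).differentiableAt_right hV hx hy),
    Finset.sum_add_distrib, Finset.sum_ite_eq', Finset.mem_univ, if_true] at h
  -- The right-hand side `∂Nⁱ_l/∂yᵐ = Γⁱ_{lm}` cancels the diagonal term `Γⁱ_{ml}`.
  have h3 : dY m (nonlinearConn F i l) x y = berwaldConn F i m l x y :=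
    berwaldConn_comm hV hG hx hy i l m
  rw [h3] at h
  simp only [mul_comm (dY m _ x y)]
  linarith

theorem sum_dX_berwaldConn_mul (hx : x ∈ V) (hy : y ≠ 0) (i l k : Fin n) :
    ∑ j, dX k (berwaldConn F i j l) x y * y j = dX k (nonlinearConn F i l) x y := by
  have hΓ := smoothOnSlit_berwaldConn hV hG
  rw [← dX_congr hV (fun x hx y hy => sum_berwaldConn_mul hV hG hE hx hy i l) hx hy k,
    dX_sum (f := fun j x y => berwaldConn F i j l x y * y j)
      fun j _ => ((hΓ i j l).mul (.coordY V j)).differentiableAt_left hV hx hy]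
  exact Finset.sum_congr rfl fun j _ => by
    rw [dX_mul_coordY ((hΓ i j l).differentiableAt_left hV hx hy), mul_comm]

theorem sum_dX_nonlinearConn_mul (hx : x ∈ V) (hy : y ≠ 0) (i k : Fin n) :
    ∑ l, dX k (nonlinearConn F i l) x y * y l = 2 * dX k (spray F i) x y := by
  have hN := smoothOnSlit_nonlinearConn hV hG
  rw [← dX_const_mul _ ((hG i).differentiableAt_left hV hx hy),
    ← dX_congr hV (hE i) hx hy k, dX_sum (f := fun j x y => nonlinearConn F i j x y * y j)
      fun j _ => ((hN i j).mul (.coordY V j)).differentiableAt_left hV hx hy]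
  exact Finset.sum_congr rfl fun j _ => by
    rw [dX_mul_coordY ((hN i j).differentiableAt_left hV hx hy), mul_comm]

theorem sum_horizontalDeriv_berwaldConn_mul (hx : x ∈ V) (hy : y ≠ 0) (i k l : Fin n) :
    ∑ j, horizontalDeriv F k (berwaldConn F i j l) x y * y j =
      dX k (nonlinearConn F i l) x y := by
  simp only [horizontalDeriv, sub_mul, Finset.sum_sub_distrib, Finset.sum_mul,
    sum_dX_berwaldConn_mul hV hG hE hx hy]
  rw [Finset.sum_comm]
  simp only [mul_assoc, ← Finset.mul_sum, sum_dY_berwaldConn_mul hV hG hE hx hy]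
  simp

/-- The Riemann curvature in terms of the spray,
`Rⁱ_k = 2 ∂_{xᵏ} Gⁱ - yˡ ∂_{xˡ} Nⁱ_k + 2 Gᵐ ∂_{yᵐ} Nⁱ_k - Nⁱ_m Nᵐ_k`. -/
theorem riemannCurvature_eq (hx : x ∈ V) (hy : y ≠ 0) (i k : Fin n) :
    riemannCurvature F i k x y = 2 * dX k (spray F i) x y
      - ∑ l, dX l (nonlinearConn F i k) x y * y l
      + 2 * ∑ m, dY m (nonlinearConn F i k) x y * spray F m x y
      - ∑ m, nonlinearConn F i m x y * nonlinearConn F m k x y := by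
  have hΓ : ∀ i l, ∑ j, berwaldConn F i j l x y * y j = nonlinearConn F i l x y :=
    fun i l => sum_berwaldConn_mul hV hG hE hx hy i l
  have h1 : ∀ l, ∑ j, berwaldCurvature F i j k l x y * y j =
      dX k (nonlinearConn F i l) x y - dX l (nonlinearConn F i k) x y
      + ∑ m, (berwaldConn F i k m x y * nonlinearConn F m l x y
        - berwaldConn F i l m x y * nonlinearConn F m k x y) := by
    intro l
    simp only [berwaldCurvature, add_mul, sub_mul, Finset.sum_add_distrib,
      Finset.sum_sub_distrib, sum_horizontalDeriv_berwaldConn_mul hV hG hE hx hy,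
      Finset.sum_mul]
    congr 2 <;> rw [Finset.sum_comm] <;>
      exact Finset.sum_congr rfl fun m _ => by rw [← hΓ]; simp only [Finset.mul_sum, mul_assoc]
  have h2 : riemannCurvature F i k x y =
      ∑ l, (∑ j, berwaldCurvature F i j k l x y * y j) * y l := by
    rw [riemannCurvature, Finset.sum_comm]
    simp only [Finset.sum_mul]
  rw [h2]
  simp only [h1, add_mul, sub_mul, Finset.sum_add_distrib,
      Finset.sum_sub_distrib, sum_dX_nonlinearConn_mul hV hG hE hx hy, Finset.sum_mul]
  have h3 : ∑ l, ∑ m, berwaldConn F i k m x y * nonlinearConn F m l x y * y l =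
      2 * ∑ m, dY m (nonlinearConn F i k) x y * spray F m x y := by
    rw [Finset.sum_comm, Finset.mul_sum]
    refine Finset.sum_congr rfl fun m _ => ?_
    simp only [mul_assoc, ← Finset.mul_sum, hE m x hx y hy]
    simp only [berwaldConn]
    ring
  have h4 : ∑ l, ∑ m, berwaldConn F i l m x y * nonlinearConn F m k x y * y l =
      ∑ m, nonlinearConn F i m x y * nonlinearConn F m k x y := by
    rw [Finset.sum_comm]
    refine Finset.sum_congr rfl fun m _ => ?_
    rw [← hΓ i m, Finset.sum_mul]
    exact Finset.sum_congr rfl fun l _ => by ring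
  rw [h3, h4]
  ring

theorem ricci_eq (hx : x ∈ V) (hy : y ≠ 0) :
    ricci F x y = 2 * ∑ i, dX i (spray F i) x y
      - ∑ l, dX l (fun x y => ∑ i, nonlinearConn F i i x y) x y * y l
      + 2 * ∑ m, dY m (fun x y => ∑ i, nonlinearConn F i i x y) x y * spray F m x y
      - ∑ i, ∑ m, nonlinearConn F i m x y * nonlinearConn F m i x y := by
  have hN := smoothOnSlit_nonlinearConn hV hG
  have h1 : ∀ l, dX l (fun x y => ∑ i, nonlinearConn F i i x y) x y =
      ∑ i, dX l (nonlinearConn F i i) x y := fun l =>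
    dX_sum (f := fun i => nonlinearConn F i i)
      (fun j _ => (hN j j).differentiableAt_left hV hx hy) l
  have h2 : ∀ l, dY l (fun x y => ∑ i, nonlinearConn F i i x y) x y =
      ∑ i, dY l (nonlinearConn F i i) x y := fun l =>
    dY_sum (f := fun i => nonlinearConn F i i)
      (fun j _ => (hN j j).differentiableAt_right hV hx hy) l
  simp only [ricci, riemannCurvature_eq hV hG hE hx hy, h1, h2, Finset.sum_add_distrib,
      Finset.sum_sub_distrib, Finset.sum_mul, ← Finset.mul_sum]
  rw [Finset.sum_comm (f := fun i l => dX l (nonlinearConn F i i) x y * y l),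
    Finset.sum_comm (f := fun i l => dY l (nonlinearConn F i i) x y * spray F l x y)]

end Ricci

/-! ### Smoothness of the spray of a Finsler metric -/

section SpraySmooth

variable {U : Set (E n)} {F : E n → E n → ℝ}

theorem IsFinslerMetric.smoothOnSlit (hF : IsFinslerMetric U F) : SmoothOnSlit U F := hF.smooth

theorem IsFinslerMetric.smoothOnSlit_fundamentalTensor (hU : IsOpen U)
    (hF : IsFinslerMetric U F) (i j : Fin n) :
    SmoothOnSlit U fun x y => fundamentalTensor F x y i j :=
  (SmoothOnSlit.const U (1 / 2)).mul (((hF.smoothOnSlit.pow 2).dY hU i).dY hU j)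

theorem smoothOnSlit_det {M : E n → E n → Matrix (Fin n) (Fin n) ℝ}
    (hM : ∀ i j, SmoothOnSlit U fun x y => M x y i j) :
    SmoothOnSlit U fun x y => (M x y).det := by
  simp only [Matrix.det_apply']
  exact .sum fun σ _ => (SmoothOnSlit.const U _).mul (.prod fun i _ => hM _ _)

theorem smoothOnSlit_matrix_inv {M : E n → E n → Matrix (Fin n) (Fin n) ℝ}
    (hM : ∀ i j, SmoothOnSlit U fun x y => M x y i j)
    (h : ∀ x ∈ U, ∀ y, y ≠ 0 → (M x y).det ≠ 0) (i j : Fin n) :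
    SmoothOnSlit U fun x y => (M x y)⁻¹ i j := by
  have hadj : SmoothOnSlit U fun x y => (M x y).adjugate i j := by
    simp only [Matrix.adjugate_apply]
    refine smoothOnSlit_det fun k l => ?_
    by_cases hk : k = j
    · subst hk
      simpa using SmoothOnSlit.const U _
    · simpa [Matrix.updateRow_ne hk] using hM k l
  refine (((smoothOnSlit_det hM).inv h).mul hadj).congr fun x _ y _ => ?_
  simp [Matrix.inv_def, Ring.inverse_eq_inv']

theorem IsFinslerMetric.smoothOnSlit_spray (hU : IsOpen U) (hF : IsFinslerMetric U F)
    (i : Fin n) : SmoothOnSlit U (spray F i) := by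
  have hL : SmoothOnSlit U fun x y => F x y ^ 2 := hF.smoothOnSlit.pow 2
  exact (SmoothOnSlit.const U (1 / 4)).mul (.sum fun l _ =>
    (smoothOnSlit_matrix_inv (hF.smoothOnSlit_fundamentalTensor hU)
      (fun x hx y hy => (hF.posDef x hx y hy).det_pos.ne') i l).mul
    ((SmoothOnSlit.sum fun k _ => ((hL.dX hU k).dY hU l).mul (.coordY U k)).sub (hL.dX hU l)))

end SpraySmooth

/-! ### Calculus of functions of `r` and `s` -/

section ProfileCalculus

/-- `f r s` is smooth in `(r, s)` on `D`, which is an open set in all uses. -/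
def SmoothProfile (D : Set (ℝ × ℝ)) (f : ℝ → ℝ → ℝ) : Prop :=
  ContDiffOn ℝ ∞ (fun p : ℝ × ℝ => f p.1 p.2) D

variable {D : Set (ℝ × ℝ)} {f g : ℝ → ℝ → ℝ} {r s : ℝ}

theorem SmoothProfile.contDiffAt (hD : IsOpen D) (hf : SmoothProfile D f) (h : (r, s) ∈ D) :
    ContDiffAt ℝ ∞ (fun p : ℝ × ℝ => f p.1 p.2) (r, s) :=
  ContDiffOn.contDiffAt hf (hD.mem_nhds h)

theorem SmoothProfile.differentiableAt (hD : IsOpen D) (hf : SmoothProfile D f)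
    (h : (r, s) ∈ D) : DifferentiableAt ℝ (fun p : ℝ × ℝ => f p.1 p.2) (r, s) :=
  (hf.contDiffAt hD h).differentiableAt (by simp)

theorem dr_eq_fderiv (hf : DifferentiableAt ℝ (fun p : ℝ × ℝ => f p.1 p.2) (r, s)) :
    dr f r s = fderiv ℝ (fun p : ℝ × ℝ => f p.1 p.2) (r, s) (1, 0) := by
  have h : HasFDerivAt (fun t => f t s) _ r :=
    HasFDerivAt.comp (g := fun p : ℝ × ℝ => f p.1 p.2) (f := fun t => (t, s)) r
      hf.hasFDerivAt (hasFDerivAt_prodMk_left r s)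
  simp [dr, h.hasDerivAt.deriv]

theorem ds_eq_fderiv (hf : DifferentiableAt ℝ (fun p : ℝ × ℝ => f p.1 p.2) (r, s)) :
    ds f r s = fderiv ℝ (fun p : ℝ × ℝ => f p.1 p.2) (r, s) (0, 1) := by
  have h : HasFDerivAt (fun t => f r t) _ s :=
    HasFDerivAt.comp (g := fun p : ℝ × ℝ => f p.1 p.2) (f := fun t => (r, t)) s
      hf.hasFDerivAt (hasFDerivAt_prodMk_right r s)
  simp [ds, h.hasDerivAt.deriv]

theorem SmoothProfile.hasDerivAt_dr (hD : IsOpen D) (hf : SmoothProfile D f)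
    (h : (r, s) ∈ D) : HasDerivAt (fun t => f t s) (dr f r s) r :=
  (DifferentiableAt.comp (g := fun p : ℝ × ℝ => f p.1 p.2) (f := fun t => (t, s)) r
    (hf.differentiableAt hD h) (by fun_prop)).hasDerivAt

theorem SmoothProfile.hasDerivAt_ds (hD : IsOpen D) (hf : SmoothProfile D f)
    (h : (r, s) ∈ D) : HasDerivAt (fun t => f r t) (ds f r s) s :=
  (DifferentiableAt.comp (g := fun p : ℝ × ℝ => f p.1 p.2) (f := fun t => (r, t)) s
    (hf.differentiableAt hD h) (by fun_prop)).hasDerivAt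

theorem SmoothProfile.dr (hD : IsOpen D) (hf : SmoothProfile D f) : SmoothProfile D (dr f) :=
  ((ContDiffOn.fderiv_of_isOpen (m := ∞) hf hD (by simp)).clm_apply
    (contDiffOn_const (c := ((1, 0) : ℝ × ℝ)))).congr
    fun _ hp => dr_eq_fderiv (hf.differentiableAt hD hp)

theorem SmoothProfile.ds (hD : IsOpen D) (hf : SmoothProfile D f) : SmoothProfile D (ds f) :=
  ((ContDiffOn.fderiv_of_isOpen (m := ∞) hf hD (by simp)).clm_apply
    (contDiffOn_const (c := ((0, 1) : ℝ × ℝ)))).congr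
    fun _ hp => ds_eq_fderiv (hf.differentiableAt hD hp)

theorem SmoothProfile.dr_ds_comm (hD : IsOpen D) (hf : SmoothProfile D f) (h : (r, s) ∈ D) :
    Finsler.dr (Finsler.ds f) r s = Finsler.ds (Finsler.dr f) r s := by
  have hc := hf.contDiffAt hD h
  have hd : DifferentiableAt ℝ (fderiv ℝ fun p : ℝ × ℝ => f p.1 p.2) (r, s) :=
    (hc.fderiv_right (m := ∞) (by simp)).differentiableAt (by simp)
  have h1 : (fun p : ℝ × ℝ => Finsler.dr f p.1 p.2) =ᶠ[nhds (r, s)]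
      fun p => fderiv ℝ (fun p : ℝ × ℝ => f p.1 p.2) p (1, 0) := by
    filter_upwards [hD.mem_nhds h] with p hp using dr_eq_fderiv (hf.differentiableAt hD hp)
  have h2 : (fun p : ℝ × ℝ => Finsler.ds f p.1 p.2) =ᶠ[nhds (r, s)]
      fun p => fderiv ℝ (fun p : ℝ × ℝ => f p.1 p.2) p (0, 1) := by
    filter_upwards [hD.mem_nhds h] with p hp using ds_eq_fderiv (hf.differentiableAt hD hp)
  rw [dr_eq_fderiv ((hf.ds hD).differentiableAt hD h),
    ds_eq_fderiv ((hf.dr hD).differentiableAt hD h), h1.fderiv_eq, h2.fderiv_eq,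
    fderiv_clm_apply hd (by fun_prop), fderiv_clm_apply hd (by fun_prop)]
  simpa using (hc.isSymmSndFDerivAt (by
    simpa using WithTop.coe_le_coe.2 (le_top : (2 : ℕ∞) ≤ ⊤))).eq (1, 0) (0, 1)

theorem SmoothProfile.mono {D' : Set (ℝ × ℝ)} (hf : SmoothProfile D f) (h : D' ⊆ D) :
    SmoothProfile D' f := ContDiffOn.mono hf h

theorem SmoothProfile.add (hf : SmoothProfile D f) (hg : SmoothProfile D g) :
    SmoothProfile D fun r s => f r s + g r s := ContDiffOn.add hf hg

theorem SmoothProfile.sub (hf : SmoothProfile D f) (hg : SmoothProfile D g) :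
    SmoothProfile D fun r s => f r s - g r s := ContDiffOn.sub hf hg

theorem SmoothProfile.mul (hf : SmoothProfile D f) (hg : SmoothProfile D g) :
    SmoothProfile D fun r s => f r s * g r s := ContDiffOn.mul hf hg

theorem SmoothProfile.pow (hf : SmoothProfile D f) (k : ℕ) :
    SmoothProfile D fun r s => f r s ^ k := ContDiffOn.pow hf k

theorem SmoothProfile.div (hf : SmoothProfile D f) (hg : SmoothProfile D g)
    (h : ∀ r s, (r, s) ∈ D → g r s ≠ 0) :
    SmoothProfile D fun r s => f r s / g r s := ContDiffOn.div hf hg fun p hp => h p.1 p.2 hp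

theorem SmoothProfile.const (D : Set (ℝ × ℝ)) (c : ℝ) : SmoothProfile D fun _ _ => c :=
  contDiffOn_const

theorem SmoothProfile.fst (D : Set (ℝ × ℝ)) : SmoothProfile D fun r _ => r := contDiffOn_fst

theorem SmoothProfile.snd (D : Set (ℝ × ℝ)) : SmoothProfile D fun _ s => s := contDiffOn_snd

end ProfileCalculus

/-! ### The functions `|y|ᵏ f(r, s)` -/

section Lift

/-- The function `|y|ᵏ f(r, s)` with `r = |x|` and `s = ⟨x, y⟩ / |y|`. Negative degrees `k` occur
after differentiation in `y`. -/
def profileLift (k : ℤ) (f : ℝ → ℝ → ℝ) (x y : E n) : ℝ :=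
  ‖y‖ ^ k * f ‖x‖ (inner ℝ x y / ‖y‖)

theorem hasFDerivAt_norm_euclidean {y : E n} (hy : y ≠ 0) :
    HasFDerivAt (fun w : E n => ‖w‖) (‖y‖⁻¹ • innerSL ℝ y) y := by
  have h := (hasStrictFDerivAt_norm_sq y).hasFDerivAt.sqrt (by simpa using hy)
  simp only [Real.sqrt_sq (norm_nonneg _)] at h
  convert! h using 1
  rw [two_smul, ← two_smul ℝ, smul_smul]
  congr 1
  field_simp

variable {f : ℝ → ℝ → ℝ} {x y : E n}

theorem hasFDerivAt_lift_right {k : ℤ} (hy : y ≠ 0)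
    (hf : DifferentiableAt ℝ (fun t => f ‖x‖ t) (inner ℝ x y / ‖y‖)) :
    HasFDerivAt (fun w => profileLift k f x w)
      (profileLift (k - 2) (fun r s => k * f r s - s * ds f r s) x y • innerSL ℝ y
        + profileLift (k - 1) (ds f) x y • innerSL ℝ x) y := by
  have hn : ‖y‖ ≠ 0 := norm_ne_zero_iff.2 hy
  have h1 := hasFDerivAt_norm_euclidean hy
  have h2 : HasFDerivAt (fun w : E n => inner ℝ x w) (innerSL ℝ x) y := (innerSL ℝ x).hasFDerivAt
  have h3 : HasFDerivAt (fun w : E n => inner ℝ x w / ‖w‖) (inner ℝ x y • -(‖y‖ ^ 2)⁻¹ •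
      ‖y‖⁻¹ • innerSL ℝ y + ‖y‖⁻¹ • innerSL ℝ x) y := by
    simpa only [div_eq_mul_inv] using! h2.mul ((hasDerivAt_inv hn).comp_hasFDerivAt y h1)
  have h4 : HasFDerivAt (fun w : E n => f ‖x‖ (inner ℝ x w / ‖w‖))
      (ds f ‖x‖ (inner ℝ x y / ‖y‖) • _) y :=
    HasDerivAt.comp_hasFDerivAt (h₂ := fun t => f ‖x‖ t) y hf.hasDerivAt h3
  have h5 := ((hasDerivAt_zpow k ‖y‖ (Or.inl hn)).comp_hasFDerivAt y h1).mul h4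
  refine h5.congr_fderiv ?_
  ext v
  simp only [profileLift, Function.comp_def, zpow_sub₀ hn, add_apply, smul_apply, smul_eq_mul,
    innerSL_apply_apply, zpow_ofNat]
  field_simp
  ring

theorem hasFDerivAt_lift_left {k : ℤ} (hx : x ≠ 0) (hy : y ≠ 0)
    (hf : DifferentiableAt ℝ (fun p : ℝ × ℝ => f p.1 p.2) (‖x‖, inner ℝ x y / ‖y‖)) :
    HasFDerivAt (fun z => profileLift k f z y)
      (profileLift k (fun r s => dr f r s / r) x y • innerSL ℝ x
        + profileLift (k - 1) (ds f) x y • innerSL ℝ y) x := by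
  have hn : ‖y‖ ≠ 0 := norm_ne_zero_iff.2 hy
  have h1 := hasFDerivAt_norm_euclidean hx
  have h2 : HasFDerivAt (fun w : E n => inner ℝ w y / ‖y‖) (‖y‖⁻¹ • innerSL ℝ y) x := by
    have h := ((innerSL ℝ y).hasFDerivAt (x := x)).const_mul ‖y‖⁻¹
    simp only [innerSL_apply_apply] at h
    simpa only [div_eq_inv_mul, real_inner_comm] using h
  have h4 := (HasFDerivAt.comp (g := fun p : ℝ × ℝ => f p.1 p.2) x hf.hasFDerivAt
    (h1.prodMk h2)).const_mul (‖y‖ ^ k)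
  refine h4.congr_fderiv ?_
  ext v
  have h5 : ∀ a b : ℝ, fderiv ℝ (fun p : ℝ × ℝ => f p.1 p.2) (‖x‖, inner ℝ x y / ‖y‖) (a, b)
      = a * dr f ‖x‖ (inner ℝ x y / ‖y‖) + b * ds f ‖x‖ (inner ℝ x y / ‖y‖) := by
    intro a b
    rw [dr_eq_fderiv hf, ds_eq_fderiv hf, ← smul_eq_mul, ← smul_eq_mul (a := b), ← map_smul,
      ← map_smul, ← map_add]
    simp
  simp only [ContinuousLinearMap.comp_apply, ContinuousLinearMap.prod_apply, h5, profileLift,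
    zpow_sub₀ hn, add_apply, smul_apply, smul_eq_mul,
    innerSL_apply_apply, zpow_one]
  field_simp

theorem dY_lift {k : ℤ} (hy : y ≠ 0)
    (hf : DifferentiableAt ℝ (fun t => f ‖x‖ t) (inner ℝ x y / ‖y‖)) (i : Fin n) :
    dY i (profileLift k f) x y = profileLift (k - 2) (fun r s => k * f r s - s * ds f r s) x y * y i
      + profileLift (k - 1) (ds f) x y * x i := by
  rw [dY, (hasFDerivAt_lift_right hy hf).fderiv]
  simp [EuclideanSpace.inner_single_right]

theorem dX_lift {k : ℤ} (hx : x ≠ 0) (hy : y ≠ 0)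
    (hf : DifferentiableAt ℝ (fun p : ℝ × ℝ => f p.1 p.2) (‖x‖, inner ℝ x y / ‖y‖))
    (i : Fin n) :
    dX i (profileLift k f) x y = profileLift k (fun r s => dr f r s / r) x y * x i
      + profileLift (k - 1) (ds f) x y * y i := by
  rw [dX, (hasFDerivAt_lift_left hx hy hf).fderiv]
  simp [EuclideanSpace.inner_single_right]

theorem SmoothProfile.smoothOnSlit_lift {D : Set (ℝ × ℝ)} {V : Set (E n)} (k : ℤ)
    (hf : SmoothProfile D f)
    (hVD : ∀ x ∈ V, ∀ y, y ≠ 0 → x ≠ 0 ∧ (‖x‖, inner ℝ x y / ‖y‖) ∈ D) :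
    SmoothOnSlit V (profileLift k f) := by
  have hny : ContDiffOn ℝ ∞ (fun p : E n × E n => ‖p.2‖) (V ×ˢ {y | y ≠ 0}) :=
    contDiffOn_snd.norm ℝ fun p hp => hp.2
  have hnx : ContDiffOn ℝ ∞ (fun p : E n × E n => ‖p.1‖) (V ×ˢ {y | y ≠ 0}) :=
    contDiffOn_fst.norm ℝ fun p hp => (hVD _ hp.1 _ hp.2).1
  have hs : ContDiffOn ℝ ∞ (fun p : E n × E n => inner ℝ p.1 p.2 / ‖p.2‖) (V ×ˢ {y | y ≠ 0}) :=
    (contDiffOn_fst.inner ℝ contDiffOn_snd).div hny fun p hp => norm_ne_zero_iff.2 hp.2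
  refine ContDiffOn.mul ?_ (ContDiffOn.comp hf (hnx.prodMk hs) fun p hp => (hVD _ hp.1 _ hp.2).2)
  intro p hp
  have : ‖p.2‖ ≠ 0 := norm_ne_zero_iff.2 hp.2
  cases k with
  | ofNat k => simpa using (hny p hp).pow k
  | negSucc k => simpa using! ((hny p hp).pow (k + 1)).inv (pow_ne_zero _ this)

end Lift

theorem sum_mul_eq_inner (x y : E n) : ∑ i, x i * y i = inner ℝ x y := by
  simp [PiLp.inner_apply, mul_comm]

/-! ### The fundamental tensor of a spherically symmetric metric -/

section SphericalSpray

theorem sphericalMetric_sq (n : ℕ) (φ : ℝ → ℝ → ℝ) :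
    (fun x y : E n => sphericalMetric n φ x y ^ 2) = profileLift 2 fun r s => φ r s ^ 2 := by
  ext x y
  simp [sphericalMetric, profileLift, mul_pow]

variable {D : Set (ℝ × ℝ)} {V : Set (E n)} {f φ : ℝ → ℝ → ℝ} {x y : E n}

theorem ds_congr {g : ℝ → ℝ → ℝ} {r s : ℝ} (hD : IsOpen D)
    (h : ∀ r s, (r, s) ∈ D → f r s = g r s) (hm : (r, s) ∈ D) : ds f r s = ds g r s := by
  have : ∀ᶠ t in nhds s, (r, t) ∈ D :=
    (Continuous.prodMk_right r).continuousAt.preimage_mem_nhds (hD.mem_nhds hm)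
  exact Filter.EventuallyEq.deriv_eq (this.mono fun t ht => h r t ht)

theorem SmoothProfile.ds_two_mul_sub {r s : ℝ} (hD : IsOpen D) (hf : SmoothProfile D f)
    (h : (r, s) ∈ D) :
    Finsler.ds (fun r s => ((2 : ℤ) : ℝ) * f r s - s * Finsler.ds f r s) r s =
      Finsler.ds f r s - s * Finsler.ds (Finsler.ds f) r s := by
  have h1 := ((hf.hasDerivAt_ds hD h).const_mul ((2 : ℤ) : ℝ)).sub
    ((hasDerivAt_id s).mul ((hf.ds hD).hasDerivAt_ds hD h))
  refine h1.deriv.trans ?_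
  simp only [id]
  push_cast
  ring

theorem SmoothProfile.sq_partials {r s : ℝ} (hD : IsOpen D) (hf : SmoothProfile D f)
    (h : (r, s) ∈ D) :
    Finsler.ds (fun r s => f r s ^ 2) r s = 2 * f r s * Finsler.ds f r s ∧
    Finsler.dr (fun r s => f r s ^ 2) r s = 2 * f r s * Finsler.dr f r s ∧
    Finsler.ds (Finsler.ds fun r s => f r s ^ 2) r s =
      2 * (Finsler.ds f r s ^ 2 + f r s * Finsler.ds (Finsler.ds f) r s) ∧
    Finsler.ds (Finsler.dr fun r s => f r s ^ 2) r s =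
      2 * (Finsler.dr f r s * Finsler.ds f r s + f r s * Finsler.ds (Finsler.dr f) r s) := by
  have hs : ∀ r s, (r, s) ∈ D →
      Finsler.ds (fun r s => f r s ^ 2) r s = 2 * f r s * Finsler.ds f r s := fun r s h =>
    ((hf.hasDerivAt_ds hD h).fun_pow 2).deriv.trans (by push_cast; ring)
  have hr : ∀ r s, (r, s) ∈ D →
      Finsler.dr (fun r s => f r s ^ 2) r s = 2 * f r s * Finsler.dr f r s := fun r s h =>
    ((hf.hasDerivAt_dr hD h).fun_pow 2).deriv.trans (by push_cast; ring)
  refine ⟨hs r s h, hr r s h, ?_, ?_⟩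
  · rw [ds_congr hD hs h]
    exact (((hf.hasDerivAt_ds hD h).const_mul 2).mul ((hf.ds hD).hasDerivAt_ds hD h)).deriv.trans
      (by ring)
  · rw [ds_congr hD hr h]
    exact (((hf.hasDerivAt_ds hD h).const_mul 2).mul ((hf.dr hD).hasDerivAt_ds hD h)).deriv.trans
      (by ring)

variable (hD : IsOpen D) (hV : IsOpen V)
  (hVD : ∀ x ∈ V, ∀ y, y ≠ 0 → x ≠ 0 ∧ (‖x‖, inner ℝ x y / ‖y‖) ∈ D)
include hD hVD

theorem SmoothProfile.dY_lift {k k₁ k₂ : ℤ} (hf : SmoothProfile D f) (hx : x ∈ V) (hy : y ≠ 0)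
    (hk₂ : k₂ = k - 2) (hk₁ : k₁ = k - 1) (i : Fin n) :
    Finsler.dY i (profileLift k f) x y =
      profileLift k₂ (fun r s => k * f r s - s * Finsler.ds f r s) x y * y i
      + profileLift k₁ (Finsler.ds f) x y * x i := by
  subst hk₁ hk₂
  exact Finsler.dY_lift hy (hf.hasDerivAt_ds hD (hVD x hx y hy).2).differentiableAt i

theorem SmoothProfile.dX_lift {k k₁ : ℤ} (hf : SmoothProfile D f) (hx : x ∈ V) (hy : y ≠ 0)
    (hk₁ : k₁ = k - 1) (i : Fin n) :
    Finsler.dX i (profileLift k f) x y = profileLift k (fun r s => Finsler.dr f r s / r) x y * x i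
      + profileLift k₁ (Finsler.ds f) x y * y i := by
  subst hk₁
  exact Finsler.dX_lift (hVD x hx y hy).1 hy (hf.differentiableAt hD (hVD x hx y hy).2) i

include hV

theorem SmoothProfile.dY_lift_mul_coordY {k k₁ k₂ : ℤ} (hf : SmoothProfile D f) (hx : x ∈ V)
    (hy : y ≠ 0) (hk₂ : k₂ = k - 2) (hk₁ : k₁ = k - 1) (i j : Fin n) :
    Finsler.dY i (fun x y => profileLift k f x y * y j) x y =
      (if j = i then profileLift k f x y else 0) +
      y j * (profileLift k₂ (fun r s => k * f r s - s * Finsler.ds f r s) x y * y i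
      + profileLift k₁ (Finsler.ds f) x y * x i) := by
  rw [Finsler.dY_mul_coordY ((hf.smoothOnSlit_lift k hVD).differentiableAt_right hV hx hy),
    hf.dY_lift hD hVD hx hy hk₂ hk₁]

theorem SmoothProfile.dY_lift_mul_coordX {k k₁ k₂ : ℤ} (hf : SmoothProfile D f) (hx : x ∈ V)
    (hy : y ≠ 0) (hk₂ : k₂ = k - 2) (hk₁ : k₁ = k - 1) (i j : Fin n) :
    Finsler.dY i (fun x y => profileLift k f x y * x j) x y =
      x j * (profileLift k₂ (fun r s => k * f r s - s * Finsler.ds f r s) x y * y i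
      + profileLift k₁ (Finsler.ds f) x y * x i) := by
  rw [Finsler.dY_mul_coordX ((hf.smoothOnSlit_lift k hVD).differentiableAt_right hV hx hy),
    hf.dY_lift hD hVD hx hy hk₂ hk₁]

theorem dY_dY_lift_two (hf : SmoothProfile D f) (hx : x ∈ V) (hy : y ≠ 0) {u r s : ℝ}
    (hu : ‖y‖ = u) (hr : ‖x‖ = r) (hs : inner ℝ x y / ‖y‖ = s) (i j : Fin n) :
    dY j (dY i (profileLift 2 f)) x y = (if i = j then 2 * f r s - s * ds f r s else 0)
      + y i * ((ds f r s - s * ds (ds f) r s) * (-(s / u ^ 2) * y j + x j / u))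
      + x i * ((ds f r s - s * ds (ds f) r s) / u * y j + ds (ds f) r s * x j) := by
  have hm := (hVD x hx y hy).2
  have h1 : SmoothProfile D fun r s => ((2 : ℤ) : ℝ) * f r s - s * ds f r s :=
    ((SmoothProfile.const D _).mul hf).sub ((SmoothProfile.snd D).mul (hf.ds hD))
  rw [dY_congr (f := dY i (profileLift 2 f)) (g := fun x y =>
      profileLift 0 (fun r s => ((2 : ℤ) : ℝ) * f r s - s * ds f r s) x y * y i
        + profileLift 1 (ds f) x y * x i)
      (fun y hy => hf.dY_lift hD hVD hx hy (by norm_num) (by norm_num) i) hy j,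
    dY_add (((h1.smoothOnSlit_lift 0 hVD).mul (.coordY V i)).differentiableAt_right hV hx hy)
      ((((hf.ds hD).smoothOnSlit_lift 1 hVD).mul (.coordX V i)).differentiableAt_right hV hx hy),
    h1.dY_lift_mul_coordY hD hV hVD hx hy (k₂ := -2) (k₁ := -1) (by norm_num) (by norm_num),
    (hf.ds hD).dY_lift_mul_coordX hD hV hVD hx hy (k₂ := -1) (k₁ := 0) (by norm_num)
      (by norm_num)]
  simp only [profileLift, hf.ds_two_mul_sub hD hm]
  rw [hs, hu, hr]
  rw [hs, hr] at hm
  have hu0 : u ≠ 0 := hu ▸ norm_ne_zero_iff.2 hy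
  simp only [zpow_neg, zpow_ofNat]
  push_cast
  split_ifs <;> field_simp <;> ring

theorem dY_dX_lift_two (hD0 : ∀ r s, (r, s) ∈ D → r ≠ 0) (hf : SmoothProfile D f)
    (hx : x ∈ V) (hy : y ≠ 0) {u r s : ℝ}
    (hu : ‖y‖ = u) (hr : ‖x‖ = r) (hs : inner ℝ x y / ‖y‖ = s) (k l : Fin n) :
    dY l (dX k (profileLift 2 f)) x y = (if k = l then u * ds f r s else 0)
      + x k * ((2 * dr f r s - s * ds (dr f) r s) / r * y l + u * ds (dr f) r s / r * x l)
      + y k * ((ds f r s - s * ds (ds f) r s) / u * y l + ds (ds f) r s * x l) := by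
  have hm := (hVD x hx y hy).2
  have hu0 : u ≠ 0 := hu ▸ norm_ne_zero_iff.2 hy
  have hr0 : r ≠ 0 := hr ▸ norm_ne_zero_iff.2 (hVD x hx y hy).1
  have h1 : SmoothProfile D fun r s => dr f r s / r :=
    (hf.dr hD).div (SmoothProfile.fst D) hD0
  have h2 : ∀ r s, ds (fun r s => dr f r s / r) r s = ds (dr f) r s / r :=
    fun r s => deriv_div_const _
  rw [dY_congr (f := dX k (profileLift 2 f))
      (g := fun x y => profileLift 2 (fun r s => dr f r s / r) x y * x k
        + profileLift 1 (ds f) x y * y k)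
      (fun y hy => hf.dX_lift hD hVD hx hy (by norm_num) k) hy l,
    dY_add (((h1.smoothOnSlit_lift 2 hVD).mul (.coordX V k)).differentiableAt_right hV hx hy)
      ((((hf.ds hD).smoothOnSlit_lift 1 hVD).mul (.coordY V k)).differentiableAt_right hV hx hy),
    h1.dY_lift_mul_coordX hD hV hVD hx hy (k₂ := 0) (k₁ := 1) (by norm_num) (by norm_num),
    (hf.ds hD).dY_lift_mul_coordY hD hV hVD hx hy (k₂ := -1) (k₁ := 0) (by norm_num)
      (by norm_num)]
  simp only [profileLift, h2]
  rw [hs, hu, hr]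
  simp only [zpow_neg, zpow_ofNat]
  push_cast
  split_ifs <;> field_simp <;> ring

/-- The fundamental tensor of `|y| φ(r, s)` applied to a vector `v`. -/
theorem sum_fundamentalTensor_mul (hφ : SmoothProfile D φ) (hx : x ∈ V) (hy : y ≠ 0) {u r s : ℝ}
    (hu : ‖y‖ = u) (hr : ‖x‖ = r) (hs : inner ℝ x y / ‖y‖ = s) (i : Fin n) (v : E n) :
    ∑ j, fundamentalTensor (sphericalMetric n φ) x y i j * v j =
      φ r s * (φ r s - s * ds φ r s) * v i
      + (φ r s * ds φ r s - s * (ds φ r s ^ 2 + φ r s * ds (ds φ) r s)) *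
        (inner ℝ x v / u - s * inner ℝ y v / u ^ 2) * y i
      + ((φ r s * ds φ r s - s * (ds φ r s ^ 2 + φ r s * ds (ds φ) r s)) * inner ℝ y v / u
        + (ds φ r s ^ 2 + φ r s * ds (ds φ) r s) * inner ℝ x v) * x i := by
  have hm := (hVD x hx y hy).2
  rw [hs, hr] at hm
  have hu0 : u ≠ 0 := hu ▸ norm_ne_zero_iff.2 hy
  obtain ⟨h1, -, h3, -⟩ := hφ.sq_partials hD hm
  simp only [fundamentalTensor, Matrix.of_apply, sphericalMetric_sq,
    dY_dY_lift_two hD hV hVD (hφ.pow 2) hx hy hu hr hs, h1, h3]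
  rw [← sum_mul_eq_inner x v, ← sum_mul_eq_inner y v]
  have key : ∀ j, (1 / 2 : ℝ) * ((if i = j then 2 * φ r s ^ 2 - s * (2 * φ r s * ds φ r s) else 0)
      + y i * ((2 * φ r s * ds φ r s - s * (2 * (ds φ r s ^ 2 + φ r s * ds (ds φ) r s))) *
        (-(s / u ^ 2) * y j + x j / u))
      + x i * ((2 * φ r s * ds φ r s - s * (2 * (ds φ r s ^ 2 + φ r s * ds (ds φ) r s))) / u * y j
        + 2 * (ds φ r s ^ 2 + φ r s * ds (ds φ) r s) * x j)) * v j =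
      (if i = j then φ r s * (φ r s - s * ds φ r s) * v j else 0)
      + (φ r s * ds φ r s - s * (ds φ r s ^ 2 + φ r s * ds (ds φ) r s)) / u * y i * (x j * v j)
      - (φ r s * ds φ r s - s * (ds φ r s ^ 2 + φ r s * ds (ds φ) r s)) * s / u ^ 2 * y i
        * (y j * v j)
      + (φ r s * ds φ r s - s * (ds φ r s ^ 2 + φ r s * ds (ds φ) r s)) / u * x i * (y j * v j)
      + (ds φ r s ^ 2 + φ r s * ds (ds φ) r s) * x i * (x j * v j) := by
    intro j
    split_ifs <;> ring
  simp only [key, Finset.sum_add_distrib, Finset.sum_sub_distrib, ← Finset.mul_sum,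
    Finset.sum_ite_eq, Finset.mem_univ, if_true]
  ring

end SphericalSpray

/-! ### Domains, and vectors with prescribed `r` and `s` -/

section Domains

theorem isOpen_ballAt (n : ℕ) (ρ : EReal) : IsOpen (ballAt n ρ) :=
  isOpen_Iio.preimage (continuous_coe_real_ereal.comp continuous_norm)

/-- The ball without its centre, where `r = |x|` is smooth. -/
def puncturedBall (n : ℕ) (ρ : EReal) : Set (E n) := {x | x ≠ 0} ∩ ballAt n ρ

theorem isOpen_puncturedBall (n : ℕ) (ρ : EReal) : IsOpen (puncturedBall n ρ) :=
  isOpen_ne.inter (isOpen_ballAt n ρ)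

/-- The interior `0 < r < ρ`, `|s| < ρ` of the domain of `φ`. It is a neighbourhood of all pairs
with `0 < r < ρ` and `|s| ≤ r`, so the partial derivatives there do not depend on values of `φ`
outside its domain. -/
def interiorDomain (ρ : EReal) : Set (ℝ × ℝ) :=
  {p | 0 < p.1} ∩ ({p | (p.1 : EReal) < ρ} ∩ {p | ((|p.2| : ℝ) : EReal) < ρ})

theorem isOpen_interiorDomain (ρ : EReal) : IsOpen (interiorDomain ρ) :=
  (isOpen_lt continuous_const continuous_fst).inter
    ((isOpen_Iio.preimage (continuous_coe_real_ereal.comp continuous_fst)).inter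
      (isOpen_Iio.preimage (continuous_coe_real_ereal.comp continuous_snd.abs)))

theorem interiorDomain_subset (ρ : EReal) : interiorDomain ρ ⊆ profileDomain ρ :=
  fun _ hp => ⟨hp.1.le, hp.2.1, hp.2.2⟩

theorem mem_interiorDomain {ρ : EReal} {r s : ℝ} (hr : 0 < r) (hrρ : (r : EReal) < ρ)
    (hs : |s| ≤ r) : (r, s) ∈ interiorDomain ρ :=
  ⟨hr, hrρ, (EReal.coe_le_coe_iff.2 hs).trans_lt hrρ⟩

theorem abs_inner_div_norm_le (x y : E n) : |inner ℝ x y / ‖y‖| ≤ ‖x‖ := by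
  rw [abs_div, abs_norm]
  exact div_le_of_le_mul₀ (norm_nonneg _) (norm_nonneg _) (abs_real_inner_le_norm x y)

theorem mem_interiorDomain_of_mem_puncturedBall {ρ : EReal} {x : E n}
    (hx : x ∈ puncturedBall n ρ) (y : E n) :
    (‖x‖, inner ℝ x y / ‖y‖) ∈ interiorDomain ρ :=
  mem_interiorDomain (norm_pos_iff.2 hx.1) hx.2 (abs_inner_div_norm_le x y)

/-- Besides `x` and `y` realising `(r, s)`, a unit vector `z ⊥ y` with `x = s y + q z` is supplied,
even when `q = 0`; this is where two dimensions are needed. -/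
theorem exists_vectors (hn : 2 ≤ n) {r s : ℝ} (hs : |s| ≤ r) :
    ∃ (x y z : E n) (q : ℝ), q ^ 2 = r ^ 2 - s ^ 2 ∧ ‖x‖ = r ∧ ‖y‖ = 1 ∧
      inner ℝ x y = s ∧ inner ℝ z z = (1 : ℝ) ∧ inner ℝ y z = (0 : ℝ) ∧ inner ℝ x z = q := by
  have h01 : (⟨0, by omega⟩ : Fin n) ≠ ⟨1, by omega⟩ := by simp
  have hr : 0 ≤ r := (abs_nonneg s).trans hs
  have hq : 0 ≤ r ^ 2 - s ^ 2 := sub_nonneg.2 (sq_le_sq.2 (by rwa [abs_of_nonneg hr]))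
  set y : E n := EuclideanSpace.single ⟨0, by omega⟩ 1
  set z : E n := EuclideanSpace.single ⟨1, by omega⟩ 1
  have hyy : inner ℝ y y = (1 : ℝ) := by simp [y]
  have hzz : inner ℝ z z = (1 : ℝ) := by simp [z]
  have hyz : inner ℝ y z = (0 : ℝ) := by
    rw [EuclideanSpace.inner_single_left]; simp [z, h01]
  have hzy : inner ℝ z y = (0 : ℝ) := by rw [real_inner_comm, hyz]
  refine ⟨s • y + √(r ^ 2 - s ^ 2) • z, y, z, √(r ^ 2 - s ^ 2), Real.sq_sqrt hq, ?_,
    by simp [y], ?_, hzz, hyz, ?_⟩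
  · rw [← sq_eq_sq₀ (norm_nonneg _) hr, ← real_inner_self_eq_norm_sq]
    simp only [inner_add_left, inner_add_right, real_inner_smul_left, real_inner_smul_right,
      hyy, hzz, hyz, hzy]
    linarith [Real.mul_self_sqrt hq]
  · rw [inner_add_left, real_inner_smul_left, real_inner_smul_left, hyy, hzy]; ring
  · rw [inner_add_left, real_inner_smul_left, real_inner_smul_left, hzz, hyz]; ring

end Domains

/-! ### Positivity of the denominator of `Q` -/

section Determinant

/-- The denominator `φ - s φ_s + (r² - s²) φ_ss` of `Q`. -/
def spraySymbol (φ : ℝ → ℝ → ℝ) (r s : ℝ) : ℝ :=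
  φ r s - s * ds φ r s + (r ^ 2 - s ^ 2) * ds (ds φ) r s

variable {ρ : EReal} {φ : ℝ → ℝ → ℝ}

/-- For unit `y ⊥ z` with `x = s y + q z`, the vector `v = z - (q φ_s / φ) y` is `g`-orthogonal to
`y`, and `g(v, v) = φ (φ - s φ_s + (r² - s²) φ_ss)`. -/
theorem spraySymbol_pos (hn : 2 ≤ n) (hφ : SmoothProfile (interiorDomain ρ) φ)
    (hφ_pos : ∀ p ∈ interiorDomain ρ, 0 < φ p.1 p.2)
    (hF : IsFinslerMetric (ballAt n ρ) (sphericalMetric n φ)) {r s : ℝ} (hr : 0 < r)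
    (hrρ : (r : EReal) < ρ) (hs : |s| ≤ r) : 0 < spraySymbol φ r s := by
  obtain ⟨x, y, z, q, hq, hx, hy, hxy, hzz, hyz, hxz⟩ := exists_vectors hn hs
  have hx0 : x ≠ 0 := norm_ne_zero_iff.1 (by rw [hx]; exact hr.ne')
  have hy0 : y ≠ 0 := norm_ne_zero_iff.1 (by rw [hy]; exact one_ne_zero)
  have hxU : x ∈ ballAt n ρ := by simpa [ballAt, hx] using hrρ
  have hm := mem_interiorDomain hr hrρ hs
  have hp : 0 < φ r s := hφ_pos _ hm
  have hyy : inner ℝ y y = (1 : ℝ) := by rw [real_inner_self_eq_norm_sq, hy]; norm_num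
  set c : ℝ := ds φ r s * q / φ r s with hc
  set v : E n := z - c • y with hv
  have hvx : inner ℝ x v = q - c * s := by
    rw [hv, inner_sub_right, real_inner_smul_right, hxz, hxy]
  have hvy : inner ℝ y v = -c := by
    rw [hv, inner_sub_right, real_inner_smul_right, hyz, hyy]; ring
  have hvv : inner ℝ v v = 1 + c ^ 2 := by
    rw [hv, inner_sub_left, inner_sub_right, inner_sub_right, real_inner_smul_right,
      real_inner_smul_left, real_inner_smul_left, real_inner_smul_right, real_inner_comm y z,
      hyz, hzz, hyy]
    ring
  have hv0 : v ≠ 0 := by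
    rintro h
    rw [h, inner_zero_left] at hvv
    nlinarith [sq_nonneg c]
  have hpos := (hF.posDef x hxU y hy0).dotProduct_mulVec_pos (x := v.ofLp)
    (by simpa using hv0)
  have hg := sum_fundamentalTensor_mul (isOpen_interiorDomain ρ) (isOpen_puncturedBall n ρ)
    (fun x hx y _ => ⟨hx.1, mem_interiorDomain_of_mem_puncturedBall hx y⟩) hφ
    (x := x) (y := y) ⟨hx0, hxU⟩ hy0 hy hx (by rw [hxy, hy, div_one])
  simp only [dotProduct, Matrix.mulVec, hg, star_trivial, mul_add, Finset.sum_add_distrib] at hpos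
  simp only [mul_left_comm (v.ofLp _), ← Finset.mul_sum] at hpos
  rw [sum_mul_eq_inner v v, sum_mul_eq_inner v y, sum_mul_eq_inner v x, real_inner_comm y v,
    real_inner_comm x v, hvx, hvy, hvv] at hpos
  have hval : 0 < φ r s * spraySymbol φ r s := by
    refine hpos.trans_eq ?_
    rw [spraySymbol, ← hq, hc]
    field_simp
    ring
  exact pos_of_mul_pos_right hval hp.le

end Determinant

/-! ### The spray of a spherically symmetric metric -/

section SprayFormula

variable {D : Set (ℝ × ℝ)} {V : Set (E n)} {φ : ℝ → ℝ → ℝ} {x y : E n}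

variable (hD : IsOpen D) (hV : IsOpen V) (hD0 : ∀ r s, (r, s) ∈ D → r ≠ 0)
  (hVD : ∀ x ∈ V, ∀ y, y ≠ 0 → x ≠ 0 ∧ (‖x‖, inner ℝ x y / ‖y‖) ∈ D)

include hD hV hD0 hVD

/-- The geodesic coefficients of `|y| φ(r, s)` are `Gⁱ = |y| P yⁱ + |y|² Q xⁱ`. The inverse of `g`
is not computed: `g` is applied to the right-hand side instead. -/
theorem sphericalMetric_spray (hφ : SmoothProfile D φ) (hx : x ∈ V) (hy : y ≠ 0)
    (hφ0 : ∀ r s, (r, s) ∈ D → φ r s ≠ 0) (hΔ : ∀ r s, (r, s) ∈ D → spraySymbol φ r s ≠ 0)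
    (hdet : (fundamentalTensor (sphericalMetric n φ) x y).det ≠ 0) (i : Fin n) :
    spray (sphericalMetric n φ) i x y =
      profileLift 1 (P φ) x y * y i + profileLift 2 (Q φ) x y * x i := by
  have hm := (hVD x hx y hy).2
  obtain ⟨r, hr⟩ : ∃ r, ‖x‖ = r := ⟨_, rfl⟩
  obtain ⟨s, hs⟩ : ∃ s, inner ℝ x y / ‖y‖ = s := ⟨_, rfl⟩
  obtain ⟨u, hu⟩ : ∃ u, ‖y‖ = u := ⟨_, rfl⟩
  rw [hs, hr] at hm
  have hu0 : u ≠ 0 := hu ▸ norm_ne_zero_iff.2 hy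
  have hr0 : r ≠ 0 := hD0 r s hm
  have hp0 : φ r s ≠ 0 := hφ0 r s hm
  have hΔ0 := hΔ r s hm
  rw [spraySymbol] at hΔ0
  have hxy : inner ℝ x y = s * u := by rw [← hs, hu, div_mul_cancel₀ _ hu0]
  have hyx : inner ℝ y x = s * u := by rw [real_inner_comm, hxy]
  have hxx : inner ℝ x x = r ^ 2 := by rw [real_inner_self_eq_norm_sq, hr]
  have hyy : inner ℝ y y = u ^ 2 := by rw [real_inner_self_eq_norm_sq, hu]
  obtain ⟨h1, h2, h3, h4⟩ := hφ.sq_partials hD hm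
  set v : E n := (u * P φ r s) • y + (u ^ 2 * Q φ r s) • x with hv
  have hvx : inner ℝ x v = u ^ 2 * (s * P φ r s + r ^ 2 * Q φ r s) := by
    rw [hv, inner_add_right, real_inner_smul_right, real_inner_smul_right, hxy, hxx]; ring
  have hvy : inner ℝ y v = u ^ 3 * (P φ r s + s * Q φ r s) := by
    rw [hv, inner_add_right, real_inner_smul_right, real_inner_smul_right, hyy, hyx]; ring
  have hvi : ∀ i, v i = u * P φ r s * y i + u ^ 2 * Q φ r s * x i := fun i => by simp [hv]
  have key : ∀ l, (∑ k, dY l (dX k fun x y => sphericalMetric n φ x y ^ 2) x y * y k)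
      - dX l (fun x y => sphericalMetric n φ x y ^ 2) x y =
      4 * ∑ j, fundamentalTensor (sphericalMetric n φ) x y l j * v j := by
    intro l
    rw [sum_fundamentalTensor_mul hD hV hVD hφ hx hy hu hr hs, hvx, hvy, hvi]
    simp only [sphericalMetric_sq, dY_dX_lift_two hD hV hVD hD0 (hφ.pow 2) hx hy hu hr hs]
    rw [(hφ.pow 2).dX_lift hD hVD hx hy (k₁ := 1) (by norm_num)]
    simp only [profileLift]
    rw [hs, hu, hr]
    simp only [h1, h2, h3, h4]
    have e : ∀ (k : Fin n) (a b c d : ℝ), ((if k = l then a else 0) + x k * b + y k * c) * y k =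
        (if k = l then a * y k else 0) + b * (x k * y k) + c * (y k * y k) := by
      intro k a b c d
      split_ifs <;> ring
    simp only [e _ _ _ _ 0, Finset.sum_add_distrib, ← Finset.mul_sum, Finset.sum_ite_eq',
      Finset.mem_univ, if_true]
    rw [sum_mul_eq_inner x y, sum_mul_eq_inner y y, hxy, hyy]
    simp only [zpow_ofNat, P, Q]
    -- As a single atom the denominator of `Q` is cleared by `field_simp`.
    generalize hΔe : φ r s - s * ds φ r s + (r ^ 2 - s ^ 2) * ds (ds φ) r s = Δ at hΔ0 ⊢
    field_simp
    rw [← hΔe]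
    ring
  -- `v` is the claimed `G`, and by `key` the defining formula of the spray reads `g⁻¹ (g v)`.
  have hmul : spray (sphericalMetric n φ) i x y =
      ((fundamentalTensor (sphericalMetric n φ) x y)⁻¹.mulVec
        ((fundamentalTensor (sphericalMetric n φ) x y).mulVec v)) i := by
    simp only [spray, key, Matrix.mulVec, dotProduct]
    rw [Finset.mul_sum]
    exact Finset.sum_congr rfl fun l _ => by ring
  rw [hmul, Matrix.mulVec_mulVec, Matrix.nonsing_inv_mul _ (isUnit_iff_ne_zero.2 hdet),
    Matrix.one_mulVec, hvi]
  simp only [profileLift]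
  rw [hs, hu, hr]
  simp

end SprayFormula

/-! ### The Ricci curvature of the spray `|y| A y + |y|² B x` -/

section RicciFormula

/-- The trace of the square of the matrix `p I + y ⊗ a + x ⊗ b`. -/
theorem sum_sum_mul_swap (p : ℝ) (x y a b : Fin n → ℝ) :
    ∑ i, ∑ m, ((if i = m then p else 0) + y i * a m + x i * b m) *
        ((if m = i then p else 0) + y m * a i + x m * b i) =
      n * p ^ 2 + 2 * p * (∑ i, y i * a i + ∑ i, x i * b i) + (∑ i, y i * a i) ^ 2
        + 2 * (∑ i, y i * b i) * (∑ i, x i * a i) + (∑ i, x i * b i) ^ 2 := by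
  have h : ∀ i m, ((if i = m then p else 0) + y i * a m + x i * b m) *
        ((if m = i then p else 0) + y m * a i + x m * b i) =
      (if i = m then p ^ 2 + 2 * p * (y m * a m + x m * b m) else 0)
      + y i * a i * (y m * a m) + y i * b i * (x m * a m) + x i * a i * (y m * b m)
      + x i * b i * (x m * b m) := by
    intro i m
    rcases eq_or_ne i m with rfl | hne
    · simp only [if_true]; ring
    · rw [if_neg hne, if_neg hne.symm, if_neg hne]; ring
  simp only [h, Finset.sum_add_distrib, ← Finset.mul_sum, ← Finset.sum_mul, Finset.sum_ite_eq,
    Finset.mem_univ, if_true, Finset.sum_const, Finset.card_univ, Fintype.card_fin, nsmul_eq_mul]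
  ring

/-- The profile of `Nⁱ_i = ∂Gⁱ/∂yⁱ` for the spray `Gⁱ = |y| A yⁱ + |y|² B xⁱ`: the trace is
`|y| ((n + 1) A + 2 s B + (r² - s²) B_s)`. -/
def sprayTrace (n : ℕ) (A B : ℝ → ℝ → ℝ) (r s : ℝ) : ℝ :=
  ((n : ℝ) + 1) * A r s + 2 * (s * B r s) + (r ^ 2 - s ^ 2) * ds B r s

variable {D : Set (ℝ × ℝ)} {V : Set (E n)} {A B : ℝ → ℝ → ℝ} {F : E n → E n → ℝ} {x y : E n}

theorem SmoothProfile.sprayTrace (hD : IsOpen D) (hA : SmoothProfile D A)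
    (hB : SmoothProfile D B) : SmoothProfile D (sprayTrace n A B) :=
  (((SmoothProfile.const D _).mul hA).add ((SmoothProfile.const D _).mul
    ((SmoothProfile.snd D).mul hB))).add
    ((((SmoothProfile.fst D).pow 2).sub ((SmoothProfile.snd D).pow 2)).mul (hB.ds hD))

theorem ds_sprayTrace (hD : IsOpen D) (hA : SmoothProfile D A)
    (hB : SmoothProfile D B) {r s : ℝ} (h : (r, s) ∈ D) :
    ds (sprayTrace n A B) r s = ((n : ℝ) + 1) * ds A r s + 2 * B r s
      + (r ^ 2 - s ^ 2) * ds (ds B) r s := by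
  have h1 := (((hA.hasDerivAt_ds hD h).const_mul ((n : ℝ) + 1)).add
    (((hasDerivAt_id s).mul (hB.hasDerivAt_ds hD h)).const_mul 2)).add
    ((((hasDerivAt_id s).fun_pow 2).const_sub (r ^ 2)).mul ((hB.ds hD).hasDerivAt_ds hD h))
  refine h1.deriv.trans ?_
  simp only [id]
  push_cast
  ring

theorem dr_sprayTrace (hD : IsOpen D) (hA : SmoothProfile D A)
    (hB : SmoothProfile D B) {r s : ℝ} (h : (r, s) ∈ D) :
    dr (sprayTrace n A B) r s = ((n : ℝ) + 1) * dr A r s + 2 * (s * dr B r s)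
      + 2 * r * ds B r s + (r ^ 2 - s ^ 2) * ds (dr B) r s := by
  have h1 := (((hA.hasDerivAt_dr hD h).const_mul ((n : ℝ) + 1)).add
    (((hB.hasDerivAt_dr hD h).const_mul s).const_mul 2)).add
    ((((hasDerivAt_id r).fun_pow 2).sub_const (s ^ 2)).mul ((hB.ds hD).hasDerivAt_dr hD h))
  refine h1.deriv.trans ?_
  rw [hB.dr_ds_comm hD h]
  simp only [id]
  push_cast
  ring

variable (hD : IsOpen D) (hV : IsOpen V)
  (hVD : ∀ x ∈ V, ∀ y, y ≠ 0 → x ≠ 0 ∧ (‖x‖, inner ℝ x y / ‖y‖) ∈ D)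
  (hA : SmoothProfile D A) (hB : SmoothProfile D B)
  (hG : ∀ i, ∀ x ∈ V, ∀ y, y ≠ 0 →
    spray F i x y = profileLift 1 A x y * y i + profileLift 2 B x y * x i)
include hD hV hVD hA hB hG

theorem nonlinearConn_eq (hx : x ∈ V) (hy : y ≠ 0) {u r s : ℝ}
    (hu : ‖y‖ = u) (hr : ‖x‖ = r) (hs : inner ℝ x y / ‖y‖ = s) (i j : Fin n) :
    nonlinearConn F i j x y = (if i = j then u * A r s else 0)
      + y i * ((A r s - s * ds A r s) / u * y j + ds A r s * x j)
      + x i * ((2 * B r s - s * ds B r s) * y j + u * ds B r s * x j) := by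
  have hu0 : u ≠ 0 := hu ▸ norm_ne_zero_iff.2 hy
  rw [nonlinearConn, dY_congr (f := spray F i)
      (g := fun x y => profileLift 1 A x y * y i + profileLift 2 B x y * x i) (hG i x hx) hy j,
    dY_add (((hA.smoothOnSlit_lift 1 hVD).mul (.coordY V i)).differentiableAt_right hV hx hy)
      (((hB.smoothOnSlit_lift 2 hVD).mul (.coordX V i)).differentiableAt_right hV hx hy),
    hA.dY_lift_mul_coordY hD hV hVD hx hy (k₂ := -1) (k₁ := 0) (by norm_num) (by norm_num),
    hB.dY_lift_mul_coordX hD hV hVD hx hy (k₂ := 0) (k₁ := 1) (by norm_num) (by norm_num)]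
  simp only [profileLift]
  rw [hs, hu, hr]
  simp only [zpow_neg, zpow_zero, zpow_one]
  push_cast
  split_ifs <;> ring

/-- Euler's relation `Nⁱ_j yʲ = 2 Gⁱ` for the spray `Gⁱ = |y| A yⁱ + |y|² B xⁱ`. -/
theorem sum_nonlinearConn_mul_eq (hx : x ∈ V) (hy : y ≠ 0) (i : Fin n) :
    ∑ j, nonlinearConn F i j x y * y j = 2 * spray F i x y := by
  obtain ⟨r, hr⟩ : ∃ r, ‖x‖ = r := ⟨_, rfl⟩
  obtain ⟨s, hs⟩ : ∃ s, inner ℝ x y / ‖y‖ = s := ⟨_, rfl⟩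
  obtain ⟨u, hu⟩ : ∃ u, ‖y‖ = u := ⟨_, rfl⟩
  have hu0 : u ≠ 0 := hu ▸ norm_ne_zero_iff.2 hy
  have hxy : inner ℝ x y = s * u := by rw [← hs, hu, div_mul_cancel₀ _ hu0]
  have hyy : inner ℝ y y = u ^ 2 := by rw [real_inner_self_eq_norm_sq, hu]
  simp only [nonlinearConn_eq hD hV hVD hA hB hG hx hy hu hr hs, hG i x hx y hy]
  have e : ∀ (j : Fin n) (a b c d e : ℝ), ((if i = j then a else 0) + y i * (b * y j + c * x j)
      + x i * (d * y j + e * x j)) * y j = (if i = j then a * y j else 0)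
      + (y i * b + x i * d) * (y j * y j) + (y i * c + x i * e) * (x j * y j) := by
    intro j a b c d e
    split_ifs <;> ring
  simp only [e, Finset.sum_add_distrib, ← Finset.mul_sum, Finset.sum_ite_eq,
    Finset.mem_univ, if_true]
  rw [sum_mul_eq_inner x y, sum_mul_eq_inner y y, hxy, hyy]
  simp only [profileLift]
  rw [hs, hu, hr]
  simp only [zpow_ofNat]
  field_simp
  ring

theorem sum_nonlinearConn_self_eq (hx : x ∈ V) (hy : y ≠ 0) :
    ∑ i, nonlinearConn F i i x y = profileLift 1 (sprayTrace n A B) x y := by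
  obtain ⟨r, hr⟩ : ∃ r, ‖x‖ = r := ⟨_, rfl⟩
  obtain ⟨s, hs⟩ : ∃ s, inner ℝ x y / ‖y‖ = s := ⟨_, rfl⟩
  obtain ⟨u, hu⟩ : ∃ u, ‖y‖ = u := ⟨_, rfl⟩
  have hu0 : u ≠ 0 := hu ▸ norm_ne_zero_iff.2 hy
  have hxy : inner ℝ x y = s * u := by rw [← hs, hu, div_mul_cancel₀ _ hu0]
  have hyy : inner ℝ y y = u ^ 2 := by rw [real_inner_self_eq_norm_sq, hu]
  have hxx : inner ℝ x x = r ^ 2 := by rw [real_inner_self_eq_norm_sq, hr]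
  simp only [nonlinearConn_eq hD hV hVD hA hB hG hx hy hu hr hs, if_true]
  have e : ∀ (i : Fin n) (a b c d e : ℝ), a + y i * (b * y i + c * x i)
      + x i * (d * y i + e * x i) = a + b * (y i * y i) + (c + d) * (x i * y i)
        + e * (x i * x i) := fun i a b c d e => by ring
  simp only [e, Finset.sum_add_distrib, ← Finset.mul_sum, Finset.sum_const, Finset.card_univ,
    Fintype.card_fin, nsmul_eq_mul]
  rw [sum_mul_eq_inner x y, sum_mul_eq_inner y y, sum_mul_eq_inner x x, hxy, hyy, hxx]
  simp only [profileLift, sprayTrace]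
  rw [hs, hu, hr]
  simp only [zpow_one]
  field_simp
  ring

theorem sum_dX_spray_eq (hx : x ∈ V) (hy : y ≠ 0) {u r s : ℝ}
    (hu : ‖y‖ = u) (hr : ‖x‖ = r) (hs : inner ℝ x y / ‖y‖ = s) :
    ∑ i, dX i (spray F i) x y = u ^ 2 * (s * dr A r s / r + ds A r s + n * B r s
      + r * dr B r s + s * ds B r s) := by
  have hu0 : u ≠ 0 := hu ▸ norm_ne_zero_iff.2 hy
  have hr0 : r ≠ 0 := hr ▸ norm_ne_zero_iff.2 (hVD x hx y hy).1
  have hxy : inner ℝ x y = s * u := by rw [← hs, hu, div_mul_cancel₀ _ hu0]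
  have hyy : inner ℝ y y = u ^ 2 := by rw [real_inner_self_eq_norm_sq, hu]
  have hxx : inner ℝ x x = r ^ 2 := by rw [real_inner_self_eq_norm_sq, hr]
  have h : ∀ i, dX i (spray F i) x y = u ^ 2 * B r s + (ds A r s) * (y i * y i)
      + (u * dr A r s / r + u * ds B r s) * (x i * y i)
      + u ^ 2 * dr B r s / r * (x i * x i) := by
    intro i
    have hAl := hA.smoothOnSlit_lift 1 hVD
    have hBl := hB.smoothOnSlit_lift 2 hVD
    rw [dX_congr hV (f := spray F i)
        (g := fun x y => profileLift 1 A x y * y i + profileLift 2 B x y * x i) (hG i) hx hy i,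
      dX_add ((hAl.mul (.coordY V i)).differentiableAt_left hV hx hy)
        ((hBl.mul (.coordX V i)).differentiableAt_left hV hx hy),
      dX_mul_coordY (hAl.differentiableAt_left hV hx hy),
      dX_mul_coordX (hBl.differentiableAt_left hV hx hy),
      hA.dX_lift hD hVD hx hy (k₁ := 0) (by norm_num),
      hB.dX_lift hD hVD hx hy (k₁ := 1) (by norm_num), if_pos rfl]
    simp only [profileLift]
    rw [hs, hu, hr]
    simp only [zpow_ofNat]
    ring
  simp only [h, Finset.sum_add_distrib, ← Finset.mul_sum, Finset.sum_const, Finset.card_univ,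
    Fintype.card_fin, nsmul_eq_mul]
  rw [sum_mul_eq_inner x y, sum_mul_eq_inner y y, sum_mul_eq_inner x x, hxy, hyy, hxx]
  field_simp
  ring

/-- The Ricci curvature of a metric with spray `Gⁱ = |y| A yⁱ + |y|² B xⁱ`. The right-hand side has
the shape of `|y|² ((n - 1) R₁ + (r² - s²) R₂)` with `A` and `B` in place of `P` and `Q`. -/
theorem ricci_eq_of_spray_eq (hx : x ∈ V) (hy : y ≠ 0) {u r s : ℝ}
    (hu : ‖y‖ = u) (hr : ‖x‖ = r) (hs : inner ℝ x y / ‖y‖ = s) :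
    ricci F x y = u ^ 2 * (((n : ℝ) - 1) * (A r s ^ 2 - 1 / r * (s * dr A r s + r * ds A r s) +
        2 * B r s * (1 + s * A r s + (r ^ 2 - s ^ 2) * ds A r s))
      + (r ^ 2 - s ^ 2) * (1 / r * (2 * dr B r s - s * ds (dr B) r s - r * ds (ds B) r s) +
        2 * B r s * (2 * B r s - s * ds B r s) +
        (r ^ 2 - s ^ 2) * (2 * B r s * ds (ds B) r s - ds B r s ^ 2))) := by
  have hm := (hVD x hx y hy).2
  rw [hs, hr] at hm
  have hu0 : u ≠ 0 := hu ▸ norm_ne_zero_iff.2 hy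
  have hr0 : r ≠ 0 := hr ▸ norm_ne_zero_iff.2 (hVD x hx y hy).1
  have hxy : inner ℝ x y = s * u := by rw [← hs, hu, div_mul_cancel₀ _ hu0]
  have hyx : inner ℝ y x = s * u := by rw [real_inner_comm, hxy]
  have hyy : inner ℝ y y = u ^ 2 := by rw [real_inner_self_eq_norm_sq, hu]
  have hxx : inner ℝ x x = r ^ 2 := by rw [real_inner_self_eq_norm_sq, hr]
  have hτ := SmoothProfile.sprayTrace (n := n) hD hA hB
  have hGs : ∀ i, SmoothOnSlit V (spray F i) := fun i =>
    (((hA.smoothOnSlit_lift 1 hVD).mul (.coordY V i)).add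
      ((hB.smoothOnSlit_lift 2 hVD).mul (.coordX V i))).congr (hG i)
  rw [ricci_eq hV hGs (fun i x hx y hy => sum_nonlinearConn_mul_eq hD hV hVD hA hB hG hx hy i)
    hx hy, sum_dX_spray_eq hD hV hVD hA hB hG hx hy hu hr hs]
  simp only [nonlinearConn_eq hD hV hVD hA hB hG hx hy hu hr hs]
  rw [sum_sum_mul_swap]
  have hT : ∀ x ∈ V, ∀ y, y ≠ 0 →
      (fun x y => ∑ i, nonlinearConn F i i x y) x y = profileLift 1 (sprayTrace n A B) x y :=
    fun x hx y hy => sum_nonlinearConn_self_eq hD hV hVD hA hB hG hx hy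
  simp only [dX_congr hV hT hx hy, dY_congr (f := fun x y => ∑ i, nonlinearConn F i i x y)
    (g := profileLift 1 (sprayTrace n A B)) (hT x hx) hy, hG _ x hx y hy,
    hτ.dX_lift hD hVD hx hy (k := 1) (k₁ := 0) (by norm_num),
    hτ.dY_lift hD hVD hx hy (k := 1) (k₂ := -1) (k₁ := 0) (by norm_num) (by norm_num)]
  have hsum : ∀ (z : E n) (a b : ℝ), ∑ i, z i * (a * y i + b * x i) =
      a * inner ℝ z y + b * inner ℝ z x := by
    intro z a b
    rw [← sum_mul_eq_inner, ← sum_mul_eq_inner, Finset.mul_sum, Finset.mul_sum,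
      ← Finset.sum_add_distrib]
    exact Finset.sum_congr rfl fun i _ => by ring
  have e1 : ∀ a b : ℝ, ∑ l, (a * x l + b * y l) * y l = a * (s * u) + b * u ^ 2 := by
    intro a b
    rw [← hxy, real_inner_comm, ← hyy, add_comm, ← hsum]
    exact Finset.sum_congr rfl fun i _ => by ring
  have e2 : ∀ a b c d : ℝ, ∑ l, (a * y l + b * x l) * (c * y l + d * x l) =
      a * c * u ^ 2 + (a * d + b * c) * (s * u) + b * d * r ^ 2 := by
    intro a b c d
    rw [← hxy, ← hyy, ← hxx, ← sum_mul_eq_inner, ← sum_mul_eq_inner, ← sum_mul_eq_inner,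
      Finset.mul_sum, Finset.mul_sum, Finset.mul_sum, ← Finset.sum_add_distrib,
      ← Finset.sum_add_distrib]
    exact Finset.sum_congr rfl fun i _ => by ring
  rw [e1, e2, hsum, hsum, hsum, hsum, hxy, hyx, hxx, hyy]
  simp only [profileLift]
  rw [hs, hu, hr, ds_sprayTrace hD hA hB hm, dr_sprayTrace hD hA hB hm, sprayTrace]
  simp only [zpow_ofNat, zpow_neg]
  push_cast
  field_simp
  ring

end RicciFormula

/-! ### Smoothness of `P` and `Q` -/

section Regularity

variable {D : Set (ℝ × ℝ)} {φ : ℝ → ℝ → ℝ} {ρ : EReal}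

theorem SmoothProfile.spraySymbol (hD : IsOpen D) (hφ : SmoothProfile D φ) :
    SmoothProfile D (spraySymbol φ) :=
  (hφ.sub ((SmoothProfile.snd D).mul (hφ.ds hD))).add
    ((((SmoothProfile.fst D).pow 2).sub ((SmoothProfile.snd D).pow 2)).mul ((hφ.ds hD).ds hD))

variable (hD : IsOpen D) (hD0 : ∀ r s, (r, s) ∈ D → r ≠ 0) (hφ : SmoothProfile D φ)
  (hΔ : ∀ r s, (r, s) ∈ D → spraySymbol φ r s ≠ 0)
include hD hD0 hφ hΔ

theorem smoothProfile_Q : SmoothProfile D (Q φ) := by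
  refine ((SmoothProfile.const D 1).div ((SmoothProfile.const D 2).mul (SmoothProfile.fst D))
    fun r s h => mul_ne_zero two_ne_zero (hD0 r s h)).mul (.div ?_ (hφ.spraySymbol hD) hΔ)
  exact (((SmoothProfile.snd D).mul ((hφ.dr hD).ds hD)).add
    ((SmoothProfile.fst D).mul ((hφ.ds hD).ds hD))).sub (hφ.dr hD)

theorem smoothProfile_P (hφ0 : ∀ r s, (r, s) ∈ D → φ r s ≠ 0) : SmoothProfile D (P φ) := by
  have hQ := smoothProfile_Q hD hD0 hφ hΔ
  have hr := SmoothProfile.fst D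
  have hs := SmoothProfile.snd D
  exact (((SmoothProfile.const D 1).div (((SmoothProfile.const D 2).mul hr).mul hφ)
    fun r s h => mul_ne_zero (mul_ne_zero two_ne_zero (hD0 r s h)) (hφ0 r s h)).mul
      ((hs.mul (hφ.dr hD)).add (hr.mul (hφ.ds hD)))).sub
    ((hQ.div hφ hφ0).mul ((hs.mul hφ).add (((hr.pow 2).sub (hs.pow 2)).mul (hφ.ds hD))))

end Regularity

/-! ### The Ricci curvature of a spherically symmetric metric -/

section Main

variable {φ : ℝ → ℝ → ℝ} {ρ : EReal}

theorem ricci_sphericalMetric (hn : 2 ≤ n) (hφ : SmoothProfile (interiorDomain ρ) φ)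
    (hφ_pos : ∀ p ∈ interiorDomain ρ, 0 < φ p.1 p.2)
    (hF : IsFinslerMetric (ballAt n ρ) (sphericalMetric n φ)) {x y : E n}
    (hx : x ∈ puncturedBall n ρ) (hy : y ≠ 0) :
    ricci (sphericalMetric n φ) x y = ‖y‖ ^ 2 *
      (((n : ℝ) - 1) * R1 φ ‖x‖ (inner ℝ x y / ‖y‖) +
        (‖x‖ ^ 2 - (inner ℝ x y / ‖y‖) ^ 2) * R2 φ ‖x‖ (inner ℝ x y / ‖y‖)) := by
  have hI := isOpen_interiorDomain ρ
  -- For `|s| > r` the denominator of `Q` may vanish, so `P` and `Q` are smooth only on this part.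
  set D : Set (ℝ × ℝ) := interiorDomain ρ ∩ {p | 0 < spraySymbol φ p.1 p.2}
  have hD : IsOpen D := (hφ.spraySymbol hI).continuousOn.isOpen_inter_preimage hI isOpen_Ioi
  have hD0 : ∀ r s, (r, s) ∈ D → r ≠ 0 := fun r s h => h.1.1.ne'
  have hφ0 : ∀ r s, (r, s) ∈ D → φ r s ≠ 0 := fun r s h => (hφ_pos _ h.1).ne'
  have hΔ : ∀ r s, (r, s) ∈ D → spraySymbol φ r s ≠ 0 := fun r s h => h.2.ne'
  have hφD : SmoothProfile D φ := hφ.mono Set.inter_subset_left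
  have hV := isOpen_puncturedBall n ρ
  have hVD : ∀ x ∈ puncturedBall n ρ, ∀ y, y ≠ 0 → x ≠ 0 ∧ (‖x‖, inner ℝ x y / ‖y‖) ∈ D :=
    fun x hx y _ => ⟨hx.1, mem_interiorDomain_of_mem_puncturedBall hx y,
      spraySymbol_pos hn hφ hφ_pos hF (norm_pos_iff.2 hx.1) hx.2 (abs_inner_div_norm_le x y)⟩
  exact ricci_eq_of_spray_eq hD hV hVD (smoothProfile_P hD hD0 hφD hΔ hφ0)
    (smoothProfile_Q hD hD0 hφD hΔ)
    (fun i x hx y hy => sphericalMetric_spray hD hV hD0 hVD hφD hx hy hφ0 hΔ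
      (hF.posDef x hx.2 y hy).det_pos.ne' i) hx hy rfl rfl rfl

/-- Identities between smooth functions extend from `x ≠ 0` to the centre of the ball. -/
theorem eq_zero_of_eq_zero_on_puncturedBall (hn : 2 ≤ n) {f : E n → E n → ℝ}
    (hf : SmoothOnSlit (ballAt n ρ) f)
    (h : ∀ x ∈ puncturedBall n ρ, ∀ y, y ≠ 0 → f x y = 0) :
    ∀ x ∈ ballAt n ρ, ∀ y, y ≠ 0 → f x y = 0 := by
  intro x hx y hy
  rcases ne_or_eq x 0 with hx0 | rfl
  · exact h x ⟨hx0, hx⟩ y hy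
  have : Nontrivial (Fin n) := Fin.nontrivial_iff_two_le.2 hn
  have hc := (hf.differentiableAt_left (isOpen_ballAt n ρ) hx hy).continuousAt
  have h0 : ∀ᶠ z in nhdsWithin (0 : E n) {0}ᶜ, f z y = 0 := by
    filter_upwards [self_mem_nhdsWithin,
      mem_nhdsWithin_of_mem_nhds ((isOpen_ballAt n ρ).mem_nhds hx)] with z hz hz'
      using h z ⟨hz, hz'⟩ y hy
  exact tendsto_nhds_unique (hc.mono_left nhdsWithin_le_nhds)
    (tendsto_const_nhds.congr' (h0.mono fun z hz => hz.symm))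

end Main

end Finsler
end

theorem theorem1p1 (n : ℕ) (hn : 2 ≤ n) (ρ : EReal) (hρ : 0 < ρ) (φ : ℝ → ℝ → ℝ)
    (hφ_smooth : ContDiffOn ℝ ∞ (fun p : ℝ × ℝ => φ p.1 p.2) (Finsler.profileDomain ρ))
    (hφ_pos : ∀ p ∈ Finsler.profileDomain ρ, 0 < φ p.1 p.2)
    (hF : Finsler.IsFinslerMetric (Finsler.ballAt n ρ) (Finsler.sphericalMetric n φ))
    (K : ℝ) :
    (∀ x ∈ Finsler.ballAt n ρ, ∀ y : Finsler.E n, y ≠ 0 →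
      Finsler.ricci (Finsler.sphericalMetric n φ) x y =
        ((n : ℝ) - 1) * K * Finsler.sphericalMetric n φ x y ^ 2) ↔
    (∀ r s : ℝ, 0 < r → (r : EReal) < ρ → |s| ≤ r →
      ((n : ℝ) - 1) * K * φ r s ^ 2 =
        ((n : ℝ) - 1) * Finsler.R1 φ r s + (r ^ 2 - s ^ 2) * Finsler.R2 φ r s) := by
  have hφ : Finsler.SmoothProfile (Finsler.interiorDomain ρ) φ :=
    hφ_smooth.mono (Finsler.interiorDomain_subset ρ)
  have hpos : ∀ p ∈ Finsler.interiorDomain ρ, 0 < φ p.1 p.2 :=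
    fun p hp => hφ_pos p (Finsler.interiorDomain_subset ρ hp)
  constructor
  · intro h r s hr hrρ hs
    obtain ⟨x, y, -, -, -, hx, hy, hxy, -⟩ := Finsler.exists_vectors hn hs
    have hx0 : x ≠ 0 := norm_ne_zero_iff.1 (by rw [hx]; exact hr.ne')
    have hy0 : y ≠ 0 := norm_ne_zero_iff.1 (by rw [hy]; exact one_ne_zero)
    have hxU : x ∈ Finsler.ballAt n ρ := by simpa [Finsler.ballAt, hx] using hrρ
    have h1 := h x hxU y hy0
    rw [Finsler.ricci_sphericalMetric hn hφ hpos hF ⟨hx0, hxU⟩ hy0, Finsler.sphericalMetric,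
      hx, hxy, hy, div_one] at h1
    linarith
  · intro h
    have hU := Finsler.isOpen_ballAt n ρ
    have hsm : Finsler.SmoothOnSlit (Finsler.ballAt n ρ) fun x y =>
        Finsler.ricci (Finsler.sphericalMetric n φ) x y -
          ((n : ℝ) - 1) * K * Finsler.sphericalMetric n φ x y ^ 2 :=
      (Finsler.smoothOnSlit_ricci hU (hF.smoothOnSlit_spray hU)).sub
        ((Finsler.SmoothOnSlit.const _ _).mul (hF.smoothOnSlit.pow 2))
    intro x hx y hy
    refine sub_eq_zero.1 (Finsler.eq_zero_of_eq_zero_on_puncturedBall hn hsm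
      (fun x hx y hy => ?_) x hx y hy)
    have h1 := h _ _ (norm_pos_iff.2 hx.1) hx.2 (Finsler.abs_inner_div_norm_le x y)
    rw [Finsler.ricci_sphericalMetric hn hφ hpos hF hx hy, Finsler.sphericalMetric, ← h1]
    ring
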